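/- **Lemma 3.1.** Let $d\ge 1$, $\tau>\frac d2$, $c_\Phi,C_\Phi>0$, and let $\Phi:\mathbb R^d\to\mathbb R$ be a continuous radial function with $\operatorname{supp}\Phi\subset\{x:\|x\|_2\le 1\}$, normalized by $\Phi(0)\le 1$, whose Fourier transform $\widehat\Phi(\omega)=(2\pi)^{-d/2}\int_{\mathbb R^d}\Phi(x)e^{-i\langle x,\omega\rangle}\,dx$ satisfies $$c_\Phi(1+\|\omega\|_2^2)^{-\tau}\le\widehat\Phi(\omega)\le C_\Phi(1+\|\omega\|_2^2)^{-\tau}\qquad(\omega\in\mathbb R^d).$$ For $\delta>0$ put $\Phi_\delta(x)=\delta^{-d}\Phi(x/\delta)$. Let $\Omega\subset\mathbb R^d$ be a bounded domain (non-empty, open, connected), and for each level $\ell\ge 1$ let $X_\ell=\{x^{(\ell)}_1,\dots,x^{(\ell)}_{N(\ell)}\}\subset\Omega$ consist of $N(\ell)\ge 2$ pairwise distinct points. Let $$h_\ell=\sup_{x\in\Omega}\min_{1\le j\le N(\ell)}\|x-x^{(\ell)}_j\|_2,\qquad q_\ell=\tfrac12\min_{j\ne k}\|x^{(\ell)}_j-x^{(\ell)}_k\|_2,$$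 and suppose that there is a constant $c_q$ with $q_\ell\le h_\ell\le c_q\,q_\ell$ for all $\ell\ge1$. Let $\nu>0$, $\delta_\ell=\nu h_\ell$, and let $$A_\ell=\bigl(\Phi_{\delta_\ell}(x^{(\ell)}_i-x^{(\ell)}_j)\bigr)_{1\le i,j\le N(\ell)}.$$ Then, for every $\ell\ge1$, the matrix $A_\ell$ is invertible and its spectral condition number $\kappa_2(A_\ell)=\|A_\ell\|_{2\to2}\|A_\ell^{-1}\|_{2\to2}$ satisfies $$\kappa_2(A_\ell)\le 4^d\,(C_d\,c_\Phi)^{-1}\bigl(1+4M_d^2\nu^2c_q^2\bigr)^\tau,$$ where $$M_d=12\left(\frac{\pi\,\Gamma(\frac d2+1)^2}{9}\right)^{\frac1{d+1}},\qquad C_d=\frac1{2\,\Gamma(\frac d2+1)}\left(\frac{M_d}{2^{3/2}}\right)^d .$$ In particular, the bound does not depend on the level $\ell$. -/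

import Mathlib

open MeasureTheory

noncomputable section

namespace MultiscaleRBF

/-- `ℝ^d` with the Euclidean norm. -/
abbrev Pt (d : ℕ) : Type := EuclideanSpace ℝ (Fin d)

/-- The Fourier transform in the convention
`Φ̂(ω) = (2π)^(-d/2) ∫ Φ(x) exp(-i ⟨x, ω⟩) dx` (angular frequency, unitary normalization). -/
def fourierHat {d : ℕ} (Φ : Pt d → ℝ) (ω : Pt d) : ℂ :=
  (((2 * Real.pi) ^ (-(d : ℝ) / 2) : ℝ) : ℂ) *
    ∫ x : Pt d, (Φ x : ℂ) * Complex.exp (-((inner ℝ x ω : ℝ) : ℂ) * Complex.I)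

/-- The hypotheses on the kernel `Φ : ℝ^d → ℝ`: continuous and radial, supported in the closed unit
ball, normalized by `Φ(0) ≤ 1`, with Fourier transform between `c (1 + ‖ω‖²)^(-τ)` and
`C (1 + ‖ω‖²)^(-τ)`. As `Φ` is radial, hence even, `Φ̂` is real-valued, so that its
real part is `Φ̂` itself. -/
structure IsAdmissibleKernel {d : ℕ} (Φ : Pt d → ℝ) (τ c C : ℝ) : Prop where
  continuous : Continuous Φ
  radial : ∃ φ : ℝ → ℝ, ∀ x, Φ x = φ ‖x‖
  support_subset : tsupport Φ ⊆ Metric.closedBall 0 1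
  apply_zero_le_one : Φ 0 ≤ 1
  smoothness : (d : ℝ) / 2 < τ
  lower_pos : 0 < c
  upper_pos : 0 < C
  lower_bound : ∀ ω, c * (1 + ‖ω‖ ^ 2) ^ (-τ) ≤ (fourierHat Φ ω).re
  upper_bound : ∀ ω, (fourierHat Φ ω).re ≤ C * (1 + ‖ω‖ ^ 2) ^ (-τ)

/-- The scaled kernel `Φ_δ(x) = δ^(-d) Φ(x / δ)`. -/
def scaledKernel {d : ℕ} (Φ : Pt d → ℝ) (δ : ℝ) (x : Pt d) : ℝ :=
  (δ ^ d)⁻¹ * Φ (δ⁻¹ • x)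

/-- The fill distance `h_{X,Ω} = sup_{x ∈ Ω} min_j ‖x - x_j‖`. -/
def fillDistance {d n : ℕ} (Ω : Set (Pt d)) (X : Fin n → Pt d) : ℝ :=
  sSup ((fun x => Metric.infDist x (Set.range X)) '' Ω)

/-- The separation distance `q_X = (1/2) min_{j ≠ k} ‖x_j - x_k‖`. -/
def separationDistance {d n : ℕ} (X : Fin n → Pt d) : ℝ :=
  (1 / 2) * sInf {r : ℝ | ∃ j k : Fin n, j ≠ k ∧ r = ‖X j - X k‖}

/-- The kernel matrix `(Φ_δ(x_i - x_j))_{i,j}` of a node set. -/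
def kernelMatrix {d n : ℕ} (Φ : Pt d → ℝ) (δ : ℝ) (X : Fin n → Pt d) :
    Matrix (Fin n) (Fin n) ℝ :=
  Matrix.of fun i j => scaledKernel Φ δ (X i - X j)

/-- The operator norm `‖A‖_{2→2}` of a square matrix. -/
def opNorm₂ {n : ℕ} (A : Matrix (Fin n) (Fin n) ℝ) : ℝ :=
  ‖Matrix.toEuclideanCLM (𝕜 := ℝ) A‖

/-- The spectral condition number `κ₂(A) = ‖A‖_{2→2} ‖A⁻¹‖_{2→2}` of an invertible matrix. -/
def cond₂ {n : ℕ} (A : Matrix (Fin n) (Fin n) ℝ) : ℝ :=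
  opNorm₂ A * opNorm₂ A⁻¹

/-- `M_d = 12 (π Γ(d/2 + 1)² / 9)^(1/(d+1))`. -/
def constM (d : ℕ) : ℝ :=
  12 * (Real.pi * Real.Gamma ((d : ℝ) / 2 + 1) ^ 2 / 9) ^ (1 / ((d : ℝ) + 1))

/-- `C_d = (1 / (2 Γ(d/2 + 1))) (M_d / 2^(3/2))^d`. -/
def constC (d : ℕ) : ℝ :=
  1 / (2 * Real.Gamma ((d : ℝ) / 2 + 1)) * (constM d / (2 : ℝ) ^ ((3 : ℝ) / 2)) ^ d

/-- The hypotheses on the node sets `X_ℓ = {x_1, …, x_{N(ℓ)}} ⊆ Ω`, `ℓ ≥ 1`, in a bounded domain `Ω`: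
each consists of at least two, pairwise distinct points, and they are quasi-uniform with the
constant `cq`, that is `q_ℓ ≤ h_ℓ ≤ cq q_ℓ`. -/
structure IsQuasiUniformFamily {d : ℕ} (Ω : Set (Pt d)) (N : ℕ → ℕ)
    (X : ∀ ℓ : ℕ, Fin (N ℓ) → Pt d) (cq : ℝ) : Prop where
  isOpen : IsOpen Ω
  isConnected : IsConnected Ω
  isBounded : Bornology.IsBounded Ω
  two_le : ∀ ℓ, 1 ≤ ℓ → 2 ≤ N ℓ
  injective : ∀ ℓ, 1 ≤ ℓ → Function.Injective (X ℓ)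
  mem : ∀ ℓ, 1 ≤ ℓ → ∀ j, X ℓ j ∈ Ω
  separation_le_fill : ∀ ℓ, 1 ≤ ℓ → separationDistance (X ℓ) ≤ fillDistance Ω (X ℓ)
  fill_le_separation : ∀ ℓ, 1 ≤ ℓ → fillDistance Ω (X ℓ) ≤ cq * separationDistance (X ℓ)

/-- The level-`ℓ` matrix `A_ℓ = (Φ_{δ_ℓ}(x_i - x_j))_{i,j}`, where `δ_ℓ = ν h_ℓ` is the scaling
parameter. -/
def levelMatrix {d : ℕ} (Φ : Pt d → ℝ) (Ω : Set (Pt d)) {N : ℕ → ℕ}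
    (X : ∀ ℓ : ℕ, Fin (N ℓ) → Pt d) (ν : ℝ) (ℓ : ℕ) : Matrix (Fin (N ℓ)) (Fin (N ℓ)) ℝ :=
  kernelMatrix Φ (ν * fillDistance Ω (X ℓ)) (X ℓ)

end MultiscaleRBF

end

/-! The eigenvalues of the symmetric matrix are pinned from both sides. From above, Schur's test
applies: `|Φ| ≤ 1` because `Φ̂ ≥ 0`, and a volume count limits the nodes within one support radius
(`card_near_le`).

From below, Fourier inversion turns the quadratic form into `∫ |E|² Φ̂` with `E` the exponential sum
of the nodes (`quadForm_eq`). On a ball of radius `r` the weight `Φ̂` is at least a fixed power of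
`1 + (2πr)²`, so it suffices that `E` has energy there proportional to `∑ a_j²`, whatever the number
of nodes. This is the Ingham type inequality `le_setIntegral_norm_sq_expSum`. For `g = (s² -
‖x‖²)₊²` the translates to `2s`-separated nodes have disjoint supports, so Plancherel evaluates both
`∫ |E|² |ĝ|²` and its gradient version `∫ |E|² (2π‖w‖)² |ĝ|²` exactly. The second controls the part
of the first outside the ball; the remainder must come from inside, where `|ĝ| ≤ ∫ g`.

Both bounds scale like `q^(-d)`, so the ratio depends only on `δ/q ≤ ν cq`. The packing count costs
`4^d` only when `q ≤ 3δ`; otherwise the matrix is a multiple of the identity, and what remains is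
that the claimed bound is at least `1` (`constC_mul_lower_le`). -/

noncomputable section

namespace MultiscaleRBF

/-! ### Plancherel for the Fourier integral on `L¹ ∩ L²` -/

open FourierTransform SchwartzMap in
/-- Plancherel's theorem for functions in `L¹ ∩ L²`: the Fourier integral represents the
`L²` Fourier transform. -/
theorem toLp_fourier_ae_eq {d : ℕ} {f : Pt d → ℂ} (h1 : Integrable f) (h2 : MemLp f 2) :
    ((𝓕 (h2.toLp f) : Lp (α := Pt d) ℂ 2 volume) : Pt d → ℂ) =ᵐ[volume] 𝓕 f := by
  have hc : Continuous (𝓕 f) :=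
    VectorFourier.fourierIntegral_continuous Real.continuous_fourierChar
      (by exact continuous_inner) h1
  have hl : LocallyIntegrable (𝓕 (h2.toLp f) : Lp (α := Pt d) ℂ 2 volume) :=
    (Lp.memLp _).locallyIntegrable (by norm_num)
  refine ae_eq_of_integral_contDiff_smul_eq hl hc.locallyIntegrable ?_
  intro g hg hgc
  have hg₁ : HasCompactSupport (Complex.ofRealCLM ∘ g) := hgc.comp_left rfl
  have hg₂ : ContDiff ℝ ((⊤ : ℕ∞) : WithTop ℕ∞) (Complex.ofRealCLM ∘ g) := by fun_prop
  set G : 𝓢(Pt d, ℂ) := hg₁.toSchwartzMap hg₂ with hG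
  have hGa : ∀ x, G x = (g x : ℂ) := fun x => rfl
  -- The `L²` transform agrees with the distributional one, so testing against `G` moves the
  -- transform onto `G`; the multiplication formula for `L¹` moves it back onto `f`.
  have key := congrArg (fun T => T G) (Lp.fourier_toTemperedDistribution_eq (h2.toLp f))
  simp only [TemperedDistribution.fourier_apply, Lp.toTemperedDistribution_apply] at key
  calc ∫ x, g x • (𝓕 (h2.toLp f) : Lp (α := Pt d) ℂ 2 volume) x
      = ∫ x, G x • (𝓕 (h2.toLp f) : Lp (α := Pt d) ℂ 2 volume) x := by
        refine integral_congr_ae (Filter.Eventually.of_forall fun x => ?_)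
        simp [hGa]
    _ = ∫ x, (𝓕 G) x • f x := by
        rw [← key]
        refine integral_congr_ae ?_
        filter_upwards [h2.coeFn_toLp] with x hx
        rw [hx]
    _ = ∫ x, G x • 𝓕 f x := by
        have := VectorFourier.integral_fourierIntegral_smul_eq_flip (L := innerₗ (Pt d))
          (μ := volume) (ν := volume) Real.continuous_fourierChar (by exact continuous_inner)
          (G.integrable (μ := volume)) h1
        simpa using! this
    _ = ∫ x, g x • 𝓕 f x := by
        refine integral_congr_ae (Filter.Eventually.of_forall fun x => ?_)
        simp [hGa]

open FourierTransform in
theorem memLp_fourier {d : ℕ} {f : Pt d → ℂ} (h1 : Integrable f) (h2 : MemLp f 2) :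
    MemLp (𝓕 f) 2 :=
  (memLp_congr_ae (toLp_fourier_ae_eq h1 h2)).1 (Lp.memLp _)

theorem integral_norm_sq_eq_norm_toLp_sq {d : ℕ} {f : Pt d → ℂ} (h2 : MemLp f 2) :
    ∫ x, ‖f x‖ ^ 2 = ‖h2.toLp f‖ ^ 2 := by
  have h := L2.inner_def (𝕜 := ℂ) (h2.toLp f) (h2.toLp f)
  have h' := inner_self_eq_norm_sq_to_K (𝕜 := ℂ) (h2.toLp f)
  have h3 : ∫ x, inner ℂ ((h2.toLp f) x) ((h2.toLp f) x) = ((∫ x, ‖f x‖ ^ 2 : ℝ) : ℂ) := by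
    rw [← integral_complex_ofReal]
    refine integral_congr_ae ?_
    filter_upwards [h2.coeFn_toLp] with x hx
    rw [hx, inner_self_eq_norm_sq_to_K]
    simp
  rw [h3, h'] at h
  exact Complex.ofReal_injective (by simpa using h.symm)

open FourierTransform in
theorem integral_norm_sq_fourier {d : ℕ} {f : Pt d → ℂ} (h1 : Integrable f) (h2 : MemLp f 2) :
    ∫ w, ‖𝓕 f w‖ ^ 2 = ∫ x, ‖f x‖ ^ 2 := by
  rw [integral_norm_sq_eq_norm_toLp_sq h2, integral_norm_sq_eq_norm_toLp_sq (memLp_fourier h1 h2),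
    ← Lp.norm_fourier_eq (h2.toLp f)]
  congr 2
  apply Lp.ext
  filter_upwards [(memLp_fourier h1 h2).coeFn_toLp, toLp_fourier_ae_eq h1 h2] with x hx hy
  rw [hx, hy]

/-! ### Exponential sums and superpositions of translates -/

/-- The exponential sum `∑ a_j exp(-2πi ⟨z_j, w⟩)`. -/
def expSum {d n : ℕ} (a : Fin n → ℝ) (z : Fin n → Pt d) (w : Pt d) : ℂ :=
  ∑ j, (a j : ℂ) * (Real.fourierChar (-(inner ℝ (z j) w)) : ℂ)

theorem continuous_expSum {d n : ℕ} (a : Fin n → ℝ) (z : Fin n → Pt d) :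
    Continuous (expSum a z) := by
  unfold expSum
  refine continuous_finsetSum _ fun j _ => continuous_const.mul ?_
  exact continuous_subtype_val.comp (Real.continuous_fourierChar.comp (by fun_prop))

/-- The superposition `∑ a_j g(x - z_j)` of translates. -/
def translateSum {d n : ℕ} (a : Fin n → ℝ) (z : Fin n → Pt d) (g : Pt d → ℂ) (x : Pt d) : ℂ :=
  ∑ j, (a j : ℂ) * g (x - z j)

theorem integrable_translateSum {d n : ℕ} (a : Fin n → ℝ) (z : Fin n → Pt d) {g : Pt d → ℂ}
    (hg : Integrable g) : Integrable (translateSum a z g) := by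
  unfold translateSum
  exact integrable_finsetSum _ fun j _ => (hg.comp_sub_right (z j)).const_mul _

theorem memLp_translateSum {d n : ℕ} (a : Fin n → ℝ) (z : Fin n → Pt d) {g : Pt d → ℂ}
    (hg : MemLp g 2) : MemLp (translateSum a z g) 2 := by
  unfold translateSum
  exact memLp_finsetSum _ fun j _ =>
    (hg.comp_measurePreserving (measurePreserving_sub_right volume (z j))).const_mul _

open FourierTransform in
theorem fourier_comp_sub {d : ℕ} (g : Pt d → ℂ) (v w : Pt d) :
    𝓕 (fun x => g (x - v)) w = (Real.fourierChar (-(inner ℝ v w)) : ℂ) * 𝓕 g w := by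
  have h := congrFun (VectorFourier.fourierIntegral_comp_add_right Real.fourierChar volume
    (innerₗ (Pt d)) g (-v)) w
  simp only [Function.comp_def, ← sub_eq_add_neg, map_neg, LinearMap.neg_apply, innerₗ_apply_apply,
    Circle.smul_def, smul_eq_mul] at h
  exact h

open FourierTransform in
theorem fourier_translateSum {d n : ℕ} (a : Fin n → ℝ) (z : Fin n → Pt d) {g : Pt d → ℂ}
    (hg : Integrable g) (w : Pt d) :
    𝓕 (translateSum a z g) w = expSum a z w * 𝓕 g w := by
  have h1 : 𝓕 (translateSum a z g) w = ∑ j, (a j : ℂ) * 𝓕 (fun x => g (x - z j)) w := by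
    simp only [Real.fourier_eq, translateSum, Finset.smul_sum]
    rw [integral_finsetSum]
    · refine Finset.sum_congr rfl fun j _ => ?_
      rw [← integral_const_mul]
      refine integral_congr_ae (Filter.Eventually.of_forall fun x => ?_)
      simp only [Circle.smul_def, smul_eq_mul]
      ring
    · intro j _
      exact (Real.fourierIntegral_convergent_iff w).2 ((hg.comp_sub_right (z j)).const_mul _)
  rw [h1, expSum, Finset.sum_mul]
  refine Finset.sum_congr rfl fun j _ => ?_
  rw [fourier_comp_sub, mul_assoc]

/-- The open balls of radius `s` around the nodes are disjoint, so at most one summand is nonzero at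
each `x` and no cross terms appear. -/
theorem norm_sq_translateSum {d n : ℕ} (a : Fin n → ℝ) {z : Fin n → Pt d} {g : Pt d → ℂ} {s : ℝ}
    (hs : ∀ x, g x ≠ 0 → ‖x‖ < s) (hz : ∀ i j, i ≠ j → 2 * s ≤ ‖z i - z j‖) (x : Pt d) :
    ‖translateSum a z g x‖ ^ 2 = ∑ j, a j ^ 2 * ‖g (x - z j)‖ ^ 2 := by
  by_cases h : ∃ k, g (x - z k) ≠ 0
  · obtain ⟨k, hk⟩ := h
    have h0 : ∀ j, j ≠ k → g (x - z j) = 0 := by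
      intro j hj
      by_contra hne
      have h1 := hs _ hk
      have h2 := hs _ hne
      have h3 := hz j k hj
      have h4 : ‖z j - z k‖ ≤ ‖x - z k‖ + ‖x - z j‖ := by
        have := norm_sub_le (x - z k) (x - z j)
        rwa [sub_sub_sub_cancel_left] at this
      linarith
    rw [translateSum, Finset.sum_eq_single k, Finset.sum_eq_single k]
    · rw [norm_mul, mul_pow]
      simp
    · intro j _ hj
      simp [h0 j hj]
    · simp
    · intro j _ hj
      simp [h0 j hj]
    · simp
  · push Not at h
    simp [translateSum, h]

theorem integral_norm_sq_translateSum {d n : ℕ} (a : Fin n → ℝ) {z : Fin n → Pt d}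
    {g : Pt d → ℂ} (hg : MemLp g 2) {s : ℝ}
    (hs : ∀ x, g x ≠ 0 → ‖x‖ < s) (hz : ∀ i j, i ≠ j → 2 * s ≤ ‖z i - z j‖) :
    ∫ x, ‖translateSum a z g x‖ ^ 2 = (∑ j, a j ^ 2) * ∫ x, ‖g x‖ ^ 2 := by
  have hi : Integrable fun x => ‖g x‖ ^ 2 := hg.integrable_norm_pow (by norm_num)
  simp only [norm_sq_translateSum a hs hz]
  rw [integral_finsetSum _ fun j _ => (hi.comp_sub_right (z j)).const_mul _, Finset.sum_mul]
  refine Finset.sum_congr rfl fun j _ => ?_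
  rw [integral_const_mul, integral_sub_right_eq_self (fun x => ‖g x‖ ^ 2)]

open FourierTransform in
theorem integrable_norm_sq_expSum_mul_fourier {d n : ℕ} (a : Fin n → ℝ) (z : Fin n → Pt d)
    {g : Pt d → ℂ} (h1 : Integrable g) (h2 : MemLp g 2) :
    Integrable fun w => ‖expSum a z w‖ ^ 2 * ‖𝓕 g w‖ ^ 2 := by
  have h := (memLp_fourier (integrable_translateSum a z h1)
    (memLp_translateSum a z h2)).integrable_norm_pow (by norm_num)
  refine h.congr (Filter.Eventually.of_forall fun w => ?_)
  simp [fourier_translateSum a z h1, mul_pow]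

open FourierTransform in
theorem integral_norm_sq_expSum_mul_fourier {d n : ℕ} (a : Fin n → ℝ) {z : Fin n → Pt d}
    {g : Pt d → ℂ} (h1 : Integrable g) (h2 : MemLp g 2) {s : ℝ}
    (hs : ∀ x, g x ≠ 0 → ‖x‖ < s) (hz : ∀ i j, i ≠ j → 2 * s ≤ ‖z i - z j‖) :
    ∫ w, ‖expSum a z w‖ ^ 2 * ‖𝓕 g w‖ ^ 2 = (∑ j, a j ^ 2) * ∫ x, ‖g x‖ ^ 2 := by
  rw [← integral_norm_sq_translateSum a h2 hs hz, ← integral_norm_sq_fourier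
    (integrable_translateSum a z h1) (memLp_translateSum a z h2)]
  refine integral_congr_ae (Filter.Eventually.of_forall fun w => ?_)
  simp [fourier_translateSum a z h1, mul_pow]

/-! ### The test function and its gradient -/

/-- The truncated paraboloid `(s² - ‖x‖²)₊`. -/
def paraboloid {d : ℕ} (s : ℝ) (x : Pt d) : ℝ := max (s ^ 2 - ‖x‖ ^ 2) 0

theorem continuous_paraboloid {d : ℕ} (s : ℝ) : Continuous (paraboloid (d := d) s) := by
  unfold paraboloid; fun_prop

theorem norm_lt_of_paraboloid_ne_zero {d : ℕ} {s : ℝ} (hs : 0 ≤ s) {x : Pt d}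
    (h : paraboloid s x ≠ 0) : ‖x‖ < s := by
  by_contra! hx
  exact h (max_eq_right (by nlinarith [norm_nonneg x]))

/-- Only `t = 0` needs care: the derivative away from it extends continuously, which forces
differentiability there. -/
theorem hasDerivAt_max_zero_sq (t : ℝ) :
    HasDerivAt (fun t : ℝ => max t 0 ^ 2) (2 * max t 0) t := by
  have key : ∀ y : ℝ, y ≠ 0 → HasDerivAt (fun t : ℝ => max t 0 ^ 2) (2 * max y 0) y := by
    intro y hy
    rcases lt_or_gt_of_ne hy with h | h
    · have : (fun t : ℝ => max t 0 ^ 2) =ᶠ[nhds y] fun _ => 0 := by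
        filter_upwards [Iio_mem_nhds h] with t ht
        simp [max_eq_right (le_of_lt (Set.mem_Iio.1 ht))]
      rw [max_eq_right h.le, mul_zero]
      exact (hasDerivAt_const y (0 : ℝ)).congr_of_eventuallyEq this
    · have : (fun t : ℝ => max t 0 ^ 2) =ᶠ[nhds y] fun t => t ^ 2 := by
        filter_upwards [Ioi_mem_nhds h] with t ht
        simp [max_eq_left (le_of_lt (Set.mem_Ioi.1 ht))]
      rw [max_eq_left h.le]
      simpa using (hasDerivAt_pow 2 y).congr_of_eventuallyEq this
  by_cases ht : t = 0
  · subst ht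
    exact hasDerivAt_of_hasDerivAt_of_ne key (by fun_prop) (by fun_prop)
  · exact key t ht

/-- The bump `(s² - ‖x‖²)₊²`, a `C¹` function supported in the ball of radius `s`. -/
def bump {d : ℕ} (s : ℝ) (x : Pt d) : ℂ := ((paraboloid s x ^ 2 : ℝ) : ℂ)

/-- The partial derivatives of `bump`. -/
def bumpPartial {d : ℕ} (s : ℝ) (i : Fin d) (x : Pt d) : ℂ :=
  ((-4 * paraboloid s x * x i : ℝ) : ℂ)

theorem continuous_bump {d : ℕ} (s : ℝ) : Continuous (bump (d := d) s) := by
  have := continuous_paraboloid (d := d) s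
  unfold bump; fun_prop

theorem continuous_bumpPartial {d : ℕ} (s : ℝ) (i : Fin d) :
    Continuous (bumpPartial (d := d) s i) := by
  have := continuous_paraboloid (d := d) s
  unfold bumpPartial; fun_prop

theorem norm_lt_of_bump_ne_zero {d : ℕ} {s : ℝ} (hs : 0 ≤ s) (x : Pt d)
    (h : bump s x ≠ 0) : ‖x‖ < s :=
  norm_lt_of_paraboloid_ne_zero hs fun h0 => h (by simp [bump, h0])

theorem norm_lt_of_bumpPartial_ne_zero {d : ℕ} {s : ℝ} (hs : 0 ≤ s) (i : Fin d) (x : Pt d)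
    (h : bumpPartial s i x ≠ 0) : ‖x‖ < s :=
  norm_lt_of_paraboloid_ne_zero hs fun h0 => h (by simp [bumpPartial, h0])

theorem hasCompactSupport_of_norm_lt {d : ℕ} {s : ℝ} {g : Pt d → ℂ}
    (h : ∀ x, g x ≠ 0 → ‖x‖ < s) : HasCompactSupport g := by
  refine HasCompactSupport.intro (isCompact_closedBall 0 s) fun x hx => ?_
  by_contra h'
  exact hx (by simpa using (h x h').le)

/-- The Fréchet derivative of `bump`. -/
def bumpDeriv {d : ℕ} (s : ℝ) (x : Pt d) : Pt d →L[ℝ] ℂ :=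
  Complex.ofRealCLM ∘L ((-4 * paraboloid s x) • innerSL ℝ x)

theorem hasFDerivAt_bump {d : ℕ} (s : ℝ) (x : Pt d) :
    HasFDerivAt (bump s) (bumpDeriv s x) x := by
  have h1 : HasFDerivAt (fun x : Pt d => s ^ 2 - ‖x‖ ^ 2) (-(2 • innerSL ℝ x)) x :=
    ((hasStrictFDerivAt_norm_sq x).hasFDerivAt).const_sub _
  have h2 := (hasDerivAt_max_zero_sq (s ^ 2 - ‖x‖ ^ 2)).comp_hasFDerivAt x h1
  have h3 := Complex.ofRealCLM.hasFDerivAt.comp x h2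
  refine h3.congr_fderiv ?_
  unfold bumpDeriv
  congr 1
  ext v
  simp [paraboloid]
  ring

theorem continuous_bumpDeriv {d : ℕ} (s : ℝ) : Continuous (bumpDeriv (d := d) s) := by
  have := continuous_paraboloid (d := d) s
  unfold bumpDeriv
  refine continuous_const.clm_comp ?_
  exact (continuous_const.mul this).smul (innerSL ℝ (E := Pt d)).continuous

theorem hasCompactSupport_bumpDeriv {d : ℕ} {s : ℝ} (hs : 0 ≤ s) :
    HasCompactSupport (bumpDeriv (d := d) s) := by
  refine HasCompactSupport.intro (isCompact_closedBall 0 s) fun x hx => ?_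
  have : paraboloid s x = 0 := by
    by_contra h
    exact hx (by simpa using (norm_lt_of_paraboloid_ne_zero hs h).le)
  ext v
  simp [bumpDeriv, this]

theorem integrable_bump {d : ℕ} {s : ℝ} (hs : 0 ≤ s) : Integrable (bump (d := d) s) :=
  (continuous_bump s).integrable_of_hasCompactSupport
    (hasCompactSupport_of_norm_lt (norm_lt_of_bump_ne_zero hs))

theorem memLp_bump {d : ℕ} {s : ℝ} (hs : 0 ≤ s) : MemLp (bump (d := d) s) 2 :=
  (continuous_bump s).memLp_of_hasCompactSupport
    (hasCompactSupport_of_norm_lt (norm_lt_of_bump_ne_zero hs))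

theorem integrable_bumpPartial {d : ℕ} {s : ℝ} (hs : 0 ≤ s) (i : Fin d) :
    Integrable (bumpPartial (d := d) s i) :=
  (continuous_bumpPartial s i).integrable_of_hasCompactSupport
    (hasCompactSupport_of_norm_lt (norm_lt_of_bumpPartial_ne_zero hs i))

theorem memLp_bumpPartial {d : ℕ} {s : ℝ} (hs : 0 ≤ s) (i : Fin d) :
    MemLp (bumpPartial (d := d) s i) 2 :=
  (continuous_bumpPartial s i).memLp_of_hasCompactSupport
    (hasCompactSupport_of_norm_lt (norm_lt_of_bumpPartial_ne_zero hs i))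

open FourierTransform in
theorem fourier_bumpPartial {d : ℕ} {s : ℝ} (hs : 0 ≤ s) (i : Fin d) (w : Pt d) :
    𝓕 (bumpPartial s i) w = 2 * Real.pi * Complex.I * (w i : ℂ) * 𝓕 (bump s) w := by
  have hd : fderiv ℝ (bump (d := d) s) = bumpDeriv s :=
    funext fun x => (hasFDerivAt_bump s x).fderiv
  have hi : Integrable (bumpDeriv (d := d) s) :=
    (continuous_bumpDeriv s).integrable_of_hasCompactSupport (hasCompactSupport_bumpDeriv hs)
  have h := Real.fourier_fderiv (integrable_bump (d := d) hs)
    (fun x => (hasFDerivAt_bump s x).differentiableAt) (hd ▸ hi)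
  rw [hd] at h
  have h' := congrArg (fun T => T w (EuclideanSpace.single i (1 : ℝ))) h
  simp only [Real.fourier_continuousLinearMap_apply hi] at h'
  have e : (fun x => bumpDeriv s x (EuclideanSpace.single i (1 : ℝ))) = bumpPartial s i := by
    ext x
    simp [bumpDeriv, bumpPartial, EuclideanSpace.inner_single_right]
  rw [e] at h'
  rw [h']
  simp [VectorFourier.fourierSMulRight_apply, innerSL_apply_apply ℝ,
    EuclideanSpace.inner_single_right]
  ring

open FourierTransform in
theorem sum_norm_sq_fourier_bumpPartial {d : ℕ} {s : ℝ} (hs : 0 ≤ s) (w : Pt d) :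
    ∑ i, ‖𝓕 (bumpPartial s i) w‖ ^ 2 = (2 * Real.pi * ‖w‖) ^ 2 * ‖𝓕 (bump s) w‖ ^ 2 := by
  simp only [fourier_bumpPartial hs, norm_mul, mul_pow, EuclideanSpace.norm_sq_eq,
    ← Finset.sum_mul, ← Finset.mul_sum, Complex.norm_real, Complex.norm_I, RCLike.norm_ofNat]
  simp

theorem sum_norm_sq_bumpPartial {d : ℕ} (s : ℝ) (x : Pt d) :
    ∑ i, ‖bumpPartial s i x‖ ^ 2 = 16 * paraboloid s x ^ 2 * ‖x‖ ^ 2 := by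
  simp only [bumpPartial, EuclideanSpace.norm_sq_eq, Complex.norm_real, Real.norm_eq_abs, sq_abs,
    mul_pow, ← Finset.mul_sum]
  norm_num

/-! ### Explicit radial integrals -/

/-- The Euclidean volume of the unit ball. -/
def unitBallVolume (d : ℕ) : ℝ := volume.real (Metric.ball (0 : Pt d) 1)

theorem unitBallVolume_eq {d : ℕ} :
    unitBallVolume d = Real.sqrt Real.pi ^ d / Real.Gamma ((d : ℝ) / 2 + 1) := by
  rcases Nat.eq_zero_or_pos d with rfl | hd
  · simp [unitBallVolume, measureReal_def, volume_euclideanSpace_eq_dirac]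
  · have : Nonempty (Fin d) := ⟨⟨0, hd⟩⟩
    have hG : 0 < Real.Gamma ((d : ℝ) / 2 + 1) := Real.Gamma_pos_of_pos (by positivity)
    rw [unitBallVolume, measureReal_def, EuclideanSpace.volume_ball]
    simp only [Fintype.card_fin, ENNReal.ofReal_one, one_pow, one_mul]
    rw [ENNReal.toReal_ofReal (by positivity)]

theorem unitBallVolume_pos {d : ℕ} : 0 < unitBallVolume d := by
  rw [unitBallVolume_eq]
  have hG : 0 < Real.Gamma ((d : ℝ) / 2 + 1) := Real.Gamma_pos_of_pos (by positivity)
  positivity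

/-- Radial integrals of truncated functions in polar coordinates. -/
theorem integral_radial {d : ℕ} (hd : 1 ≤ d) {s : ℝ} (hs : 0 ≤ s) {f : ℝ → ℝ} {g : ℝ → ℝ}
    (hfg : ∀ r, 0 < r → r ≤ s → r ^ (d - 1) * f r = g r) (hf : ∀ r, s < r → f r = 0) :
    ∫ x : Pt d, f ‖x‖ = d * unitBallVolume d * ∫ r in (0 : ℝ)..s, g r := by
  have : Nonempty (Fin d) := ⟨⟨0, hd⟩⟩
  rw [integral_fun_norm_addHaar volume f]
  simp only [finrank_euclideanSpace, Fintype.card_fin, nsmul_eq_mul, smul_eq_mul]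
  rw [unitBallVolume, mul_assoc, intervalIntegral.integral_of_le hs]
  congr 2
  rw [setIntegral_congr_fun measurableSet_Ioc (fun r hr => (hfg r hr.1 hr.2).symm)]
  refine setIntegral_eq_of_subset_of_forall_sdiff_eq_zero measurableSet_Ioi
    (fun r hr => hr.1) fun r hr => ?_
  have : s < r := by
    by_contra! h
    exact hr.2 ⟨hr.1, h⟩
  simp [hf r this]

theorem integral_bump {d : ℕ} (hd : 1 ≤ d) {s : ℝ} (hs : 0 ≤ s) :
    ∫ x : Pt d, paraboloid s x ^ 2 =
      unitBallVolume d * s ^ (d + 4) * (8 / ((d + 2) * (d + 4))) := by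
  refine (integral_radial (f := fun r => max (s ^ 2 - r ^ 2) 0 ^ 2)
    (g := fun r => s ^ 4 * r ^ (d - 1) - 2 * s ^ 2 * r ^ (d + 1)
    + r ^ (d + 3))
    hd hs ?_ ?_).trans ?_
  rotate_left 2
  · rw [intervalIntegral.integral_add, intervalIntegral.integral_sub,
      intervalIntegral.integral_const_mul, intervalIntegral.integral_const_mul, integral_pow,
      integral_pow, integral_pow]
    · obtain ⟨e, rfl⟩ : ∃ e, d = e + 1 := ⟨d - 1, by omega⟩
      push_cast
      field_simp
      ring
    all_goals exact Continuous.intervalIntegrable (by fun_prop) _ _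
  · intro r h1 h2
    obtain ⟨e, rfl⟩ : ∃ e, d = e + 1 := ⟨d - 1, by omega⟩
    simp only [Nat.add_sub_cancel]
    rw [max_eq_left (by nlinarith)]
    ring
  · intro r h
    rw [max_eq_right (by nlinarith)]
    simp

theorem integral_bump_sq {d : ℕ} (hd : 1 ≤ d) {s : ℝ} (hs : 0 ≤ s) :
    ∫ x : Pt d, paraboloid s x ^ 4 =
      unitBallVolume d * s ^ (d + 8) * (384 / ((d + 2) * (d + 4) * (d + 6) * (d + 8))) := by
  refine (integral_radial (f := fun r => max (s ^ 2 - r ^ 2) 0 ^ 4)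
    (g := fun r => s ^ 8 * r ^ (d - 1) - 4 * s ^ 6 * r ^ (d + 1)
    + 6 * s ^ 4 * r ^ (d + 3) - 4 * s ^ 2 * r ^ (d + 5) + r ^ (d + 7))
    hd hs ?_ ?_).trans ?_
  rotate_left 2
  · rw [intervalIntegral.integral_add, intervalIntegral.integral_sub,
      intervalIntegral.integral_add, intervalIntegral.integral_sub]
    · simp only [intervalIntegral.integral_const_mul, integral_pow]
      obtain ⟨e, rfl⟩ : ∃ e, d = e + 1 := ⟨d - 1, by omega⟩
      push_cast
      field_simp
      ring
    all_goals exact Continuous.intervalIntegrable (by fun_prop) _ _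
  · intro r h1 h2
    obtain ⟨e, rfl⟩ : ∃ e, d = e + 1 := ⟨d - 1, by omega⟩
    simp only [Nat.add_sub_cancel]
    rw [max_eq_left (by nlinarith)]
    ring
  · intro r h
    rw [max_eq_right (by nlinarith)]
    simp

theorem integral_paraboloid_sq_mul_norm_sq {d : ℕ} (hd : 1 ≤ d) {s : ℝ} (hs : 0 ≤ s) :
    ∫ x : Pt d, paraboloid s x ^ 2 * ‖x‖ ^ 2 =
      unitBallVolume d * s ^ (d + 6) * (8 * d / ((d + 2) * (d + 4) * (d + 6))) := by
  refine (integral_radial (f := fun r => max (s ^ 2 - r ^ 2) 0 ^ 2 * r ^ 2)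
    (g := fun r => s ^ 4 * r ^ (d + 1) - 2 * s ^ 2 * r ^ (d + 3)
    + r ^ (d + 5))
    hd hs ?_ ?_).trans ?_
  rotate_left 2
  · rw [intervalIntegral.integral_add, intervalIntegral.integral_sub,
      intervalIntegral.integral_const_mul, intervalIntegral.integral_const_mul, integral_pow,
      integral_pow, integral_pow]
    · push_cast
      field_simp
      ring
    all_goals exact Continuous.intervalIntegrable (by fun_prop) _ _
  · intro r h1 h2
    obtain ⟨e, rfl⟩ : ∃ e, d = e + 1 := ⟨d - 1, by omega⟩
    simp only [Nat.add_sub_cancel]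
    rw [max_eq_left (by nlinarith)]
    ring
  · intro r h
    rw [max_eq_right (by nlinarith)]
    simp

/-! ### The Ingham type inequality -/

open FourierTransform in
theorem norm_fourier_bump_le {d : ℕ} (s : ℝ) (w : Pt d) :
    ‖𝓕 (bump s) w‖ ≤ ∫ x : Pt d, paraboloid s x ^ 2 := by
  refine (VectorFourier.norm_fourierIntegral_le_integral_norm _ _ _ _ _).trans_eq ?_
  refine integral_congr_ae (Filter.Eventually.of_forall fun x => ?_)
  simp only [bump, Complex.norm_real, Real.norm_eq_abs, abs_pow, sq_abs]

open FourierTransform in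
/-- An Ingham type inequality: the energy of an exponential sum with `2s`-separated frequencies on
a ball of radius `r ≥ (d + 2) / (2πs)` is bounded from below. -/
theorem le_setIntegral_norm_sq_expSum {d n : ℕ} (hd : 1 ≤ d) (a : Fin n → ℝ) {z : Fin n → Pt d}
    {s r : ℝ} (hs : 0 < s) (hz : ∀ i j, i ≠ j → 2 * s ≤ ‖z i - z j‖) (hr : 0 < r)
    (hrs : (d + 2 : ℝ) ≤ 2 * Real.pi * r * s) :
    (5 / 9) / (unitBallVolume d * s ^ d) * ∑ j, a j ^ 2 ≤
      ∫ w in Metric.closedBall (0 : Pt d) r, ‖expSum a z w‖ ^ 2 := by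
  set S := ∑ j, a j ^ 2 with hS
  set V := unitBallVolume d with hV
  have hVpos : 0 < V := unitBallVolume_pos
  have hSnn : 0 ≤ S := Finset.sum_nonneg fun j _ => sq_nonneg _
  set I := ∫ x : Pt d, paraboloid s x ^ 2 with hI
  have hIv := integral_bump hd hs.le
  have hIpos : 0 < I := by rw [hI, hIv]; positivity
  have hH := integral_norm_sq_expSum_mul_fourier a (integrable_bump hs.le) (memLp_bump hs.le)
    (norm_lt_of_bump_ne_zero hs.le) hz
  have hHi := integrable_norm_sq_expSum_mul_fourier a z (integrable_bump hs.le) (memLp_bump hs.le)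
  have hP := fun i => integral_norm_sq_expSum_mul_fourier a (integrable_bumpPartial hs.le i)
    (memLp_bumpPartial hs.le i) (norm_lt_of_bumpPartial_ne_zero hs.le i) hz
  have hPi := fun i => integrable_norm_sq_expSum_mul_fourier a z (integrable_bumpPartial hs.le i)
    (memLp_bumpPartial hs.le i)
  have hG : ∫ w, ‖expSum a z w‖ ^ 2 * ((2 * Real.pi * ‖w‖) ^ 2 * ‖𝓕 (bump s) w‖ ^ 2) =
      S * (16 * ∫ x : Pt d, paraboloid s x ^ 2 * ‖x‖ ^ 2) := by
    simp only [← sum_norm_sq_fourier_bumpPartial hs.le, Finset.mul_sum]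
    rw [integral_finsetSum _ fun i _ => hPi i]
    simp only [hP]
    rw [← Finset.mul_sum, ← integral_finsetSum _ fun i _ =>
      (memLp_bumpPartial hs.le i).integrable_norm_pow (by norm_num)]
    simp only [sum_norm_sq_bumpPartial, mul_assoc]
    rw [integral_const_mul]
  have hGi : Integrable fun w =>
      ‖expSum a z w‖ ^ 2 * ((2 * Real.pi * ‖w‖) ^ 2 * ‖𝓕 (bump s) w‖ ^ 2) := by
    simp only [← sum_norm_sq_fourier_bumpPartial hs.le, Finset.mul_sum]
    exact integrable_finsetSum _ fun i _ => hPi i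
  have hBi : Integrable ((Metric.closedBall (0 : Pt d) r).indicator
      fun w => ‖expSum a z w‖ ^ 2) := by
    rw [integrable_indicator_iff Metric.isClosed_closedBall.measurableSet]
    exact ((continuous_expSum a z).norm.pow 2).continuousOn.integrableOn_compact
      (isCompact_closedBall 0 r)
  -- Pointwise split: inside the ball `|ĝ| ≤ I`; outside, the factor `(‖w‖/r)² ≥ 1` can be inserted,
  -- producing the gradient energy.
  have hle : S * ∫ x, ‖bump (d := d) s x‖ ^ 2 ≤
      I ^ 2 * (∫ w in Metric.closedBall (0 : Pt d) r, ‖expSum a z w‖ ^ 2) +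
        ((2 * Real.pi * r) ^ 2)⁻¹ * (S * (16 * ∫ x : Pt d, paraboloid s x ^ 2 * ‖x‖ ^ 2)) := by
    rw [← hH, ← hG, ← integral_indicator Metric.isClosed_closedBall.measurableSet,
      ← integral_const_mul, ← integral_const_mul, ← integral_add (hBi.const_mul _)
        (hGi.const_mul _)]
    refine integral_mono hHi ((hBi.const_mul _).add (hGi.const_mul _)) fun w => ?_
    have hF := norm_fourier_bump_le s w
    have hpi := Real.pi_pos
    simp only
    by_cases hw : w ∈ Metric.closedBall (0 : Pt d) r
    · rw [Set.indicator_of_mem hw]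
      have : ‖𝓕 (bump s) w‖ ^ 2 ≤ I ^ 2 := by gcongr
      have h2 : 0 ≤ ((2 * Real.pi * r) ^ 2)⁻¹ *
        (‖expSum a z w‖ ^ 2 * ((2 * Real.pi * ‖w‖) ^ 2 * ‖𝓕 (bump s) w‖ ^ 2)) := by positivity
      nlinarith [sq_nonneg ‖expSum a z w‖]
    · rw [Set.indicator_of_notMem hw]
      have hw' : r ≤ ‖w‖ := by
        by_contra! h
        exact hw (by simpa using h.le)
      have h3 : 1 ≤ ((2 * Real.pi * r) ^ 2)⁻¹ * (2 * Real.pi * ‖w‖) ^ 2 := by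
        rw [← div_eq_inv_mul, one_le_div (by positivity)]
        gcongr
      have h4 : 0 ≤ ‖expSum a z w‖ ^ 2 * ‖𝓕 (bump s) w‖ ^ 2 := by positivity
      calc _ ≤ _ := le_mul_of_one_le_left h4 h3
        _ = _ := by ring
  have hnorm : ∫ x, ‖bump (d := d) s x‖ ^ 2 = ∫ x : Pt d, paraboloid s x ^ 4 := by
    refine integral_congr_ae (Filter.Eventually.of_forall fun x => ?_)
    simp only [bump, Complex.norm_real, Real.norm_eq_abs, sq_abs]
    ring
  set B := ∫ w in Metric.closedBall (0 : Pt d) r, ‖expSum a z w‖ ^ 2 with hB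
  set J := ∫ x : Pt d, paraboloid s x ^ 4 with hJ
  have hJv := integral_bump_sq hd hs.le
  have hKv := integral_paraboloid_sq_mul_norm_sq hd hs.le
  rw [hnorm] at hle
  -- The ratio is at most `d(d+8) / (3(d+2)²)`, whose maximum `4/9` is attained at `d = 4`; this
  -- leaves the constant `5/9`.
  have hgrad : ((2 * Real.pi * r) ^ 2)⁻¹ * (16 * ∫ x : Pt d, paraboloid s x ^ 2 * ‖x‖ ^ 2) ≤
      4 / 9 * J := by
    have e1 : 16 * ∫ x : Pt d, paraboloid s x ^ 2 * ‖x‖ ^ 2 = d * (d + 8) / (3 * s ^ 2) * J := by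
      rw [hJ, hJv, hKv]
      field_simp
      ring
    have hJ0 : 0 ≤ J := by rw [hJ, hJv]; positivity
    have hpi := Real.pi_pos
    rw [e1, ← mul_assoc]
    refine mul_le_mul_of_nonneg_right ?_ hJ0
    rw [← div_eq_inv_mul, div_div, div_le_div_iff₀ (by positivity) (by norm_num)]
    have h5 : ((d : ℝ) + 2) ^ 2 ≤ (2 * Real.pi * r * s) ^ 2 := by gcongr
    nlinarith [sq_nonneg ((d : ℝ) - 4)]
  -- The Cauchy–Schwarz bound for `g` on the ball of radius `s`, checked here from the explicit
  -- values.
  have hcs : I ^ 2 ≤ V * s ^ d * J := by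
    rw [hI, hJ, hIv, hJv, ← hV]
    have h6 : (8 / (((d : ℝ) + 2) * (d + 4))) ^ 2 ≤
        384 / ((d + 2) * (d + 4) * (d + 6) * (d + 8)) := by
      rw [div_pow, div_le_div_iff₀ (by positivity) (by positivity)]
      have hd0 : (0 : ℝ) ≤ d := by positivity
      have : ((d : ℝ) + 6) * (d + 8) ≤ 6 * ((d + 2) * (d + 4)) := by nlinarith
      nlinarith [mul_le_mul_of_nonneg_left this
        (by positivity : (0 : ℝ) ≤ 64 * ((d + 2) * (d + 4)))]
    calc (V * s ^ (d + 4) * (8 / (((d : ℝ) + 2) * (d + 4)))) ^ 2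
        = (V * s ^ (d + 4)) ^ 2 * (8 / (((d : ℝ) + 2) * (d + 4))) ^ 2 := by ring
      _ ≤ (V * s ^ (d + 4)) ^ 2 * (384 / ((d + 2) * (d + 4) * (d + 6) * (d + 8))) := by gcongr
      _ = _ := by ring
  have h7 : 5 / 9 * S * J ≤ I ^ 2 * B := by nlinarith
  have h8 : 5 / 9 * S * I ^ 2 ≤ V * s ^ d * (I ^ 2 * B) := by
    calc 5 / 9 * S * I ^ 2 ≤ 5 / 9 * S * (V * s ^ d * J) := by gcongr
      _ = V * s ^ d * (5 / 9 * S * J) := by ring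
      _ ≤ _ := by gcongr
  have h9 : 5 / 9 * S ≤ V * s ^ d * B := by
    refine le_of_mul_le_mul_right ?_ (by positivity : 0 < I ^ 2)
    linarith
  rw [div_mul_eq_mul_div, div_le_iff₀ (by positivity)]
  linarith

/-! ### Fourier representation of the kernel and its quadratic form -/

/-- The Fourier transform of a real function, in Mathlib's normalization. -/
def kernelFourier {d : ℕ} (Φ : Pt d → ℝ) (w : Pt d) : ℂ :=
  FourierTransform.fourier (fun x => (Φ x : ℂ)) w

theorem kernelFourier_eq_fourierHat {d : ℕ} (Φ : Pt d → ℝ) (w : Pt d) :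
    kernelFourier Φ w =
      (((2 * Real.pi) ^ ((d : ℝ) / 2) : ℝ) : ℂ) * fourierHat Φ ((2 * Real.pi) • w) := by
  have hpi : 0 < 2 * Real.pi := by positivity
  rw [fourierHat, ← mul_assoc, ← Complex.ofReal_mul, ← Real.rpow_add hpi, neg_div, add_neg_cancel,
    Real.rpow_zero, Complex.ofReal_one, one_mul, kernelFourier, Real.fourier_eq']
  refine integral_congr_ae (Filter.Eventually.of_forall fun x => ?_)
  simp only [smul_eq_mul, inner_smul_right]
  rw [mul_comm]
  congr 2
  push_cast
  ring

namespace IsAdmissibleKernel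

variable {d : ℕ} {Φ : Pt d → ℝ} {τ c C : ℝ}

theorem apply_neg (h : IsAdmissibleKernel Φ τ c C) (x : Pt d) : Φ (-x) = Φ x := by
  obtain ⟨φ, hφ⟩ := h.radial
  rw [hφ, hφ, norm_neg]

theorem eq_zero_of_one_lt_norm (h : IsAdmissibleKernel Φ τ c C) {x : Pt d} (hx : 1 < ‖x‖) :
    Φ x = 0 := by
  by_contra h0
  have := h.support_subset (subset_tsupport Φ h0)
  simp only [mem_closedBall_zero_iff] at this
  linarith

theorem hasCompactSupport (h : IsAdmissibleKernel Φ τ c C) : HasCompactSupport Φ :=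
  (isCompact_closedBall 0 1).of_isClosed_subset (isClosed_tsupport Φ) h.support_subset

theorem integrable (h : IsAdmissibleKernel Φ τ c C) : Integrable Φ :=
  h.continuous.integrable_of_hasCompactSupport h.hasCompactSupport

theorem tau_pos (h : IsAdmissibleKernel Φ τ c C) : 0 < τ :=
  lt_of_le_of_lt (by positivity) h.smoothness

/-- Conjugation amounts to `x ↦ -x` in the integral, and `Φ` is even. -/
theorem conj_kernelFourier (h : IsAdmissibleKernel Φ τ c C) (w : Pt d) :
    (starRingEnd ℂ) (kernelFourier Φ w) = kernelFourier Φ w := by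
  unfold kernelFourier
  rw [Real.fourier_eq', ← integral_conj, ← integral_neg_eq_self]
  refine integral_congr_ae (Filter.Eventually.of_forall fun x => ?_)
  simp [h.apply_neg, ← Complex.exp_conj, map_ofNat]

theorem ofReal_re_kernelFourier (h : IsAdmissibleKernel Φ τ c C) (w : Pt d) :
    ((kernelFourier Φ w).re : ℂ) = kernelFourier Φ w :=
  Complex.conj_eq_iff_re.1 (h.conj_kernelFourier w)

theorem re_kernelFourier (Φ : Pt d → ℝ) (w : Pt d) :
    (kernelFourier Φ w).re =
      (2 * Real.pi) ^ ((d : ℝ) / 2) * (fourierHat Φ ((2 * Real.pi) • w)).re := by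
  rw [kernelFourier_eq_fourierHat, Complex.re_ofReal_mul]

theorem le_re_kernelFourier (h : IsAdmissibleKernel Φ τ c C) {r : ℝ} {w : Pt d} (hw : ‖w‖ ≤ r) :
    (2 * Real.pi) ^ ((d : ℝ) / 2) * (c * (1 + (2 * Real.pi * r) ^ 2) ^ (-τ)) ≤
      (kernelFourier Φ w).re := by
  have hpi := Real.pi_pos
  have hc := h.lower_pos
  rw [re_kernelFourier]
  refine mul_le_mul_of_nonneg_left (le_trans ?_ (h.lower_bound _)) (by positivity)
  refine mul_le_mul_of_nonneg_left ?_ hc.le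
  refine Real.rpow_le_rpow_of_nonpos (by positivity) ?_ (by linarith [h.tau_pos])
  rw [norm_smul, Real.norm_of_nonneg (by positivity)]
  gcongr

theorem re_kernelFourier_nonneg (h : IsAdmissibleKernel Φ τ c C) (w : Pt d) :
    0 ≤ (kernelFourier Φ w).re := by
  have hc := h.lower_pos
  have hpi := Real.pi_pos
  exact le_trans (by positivity) (h.le_re_kernelFourier le_rfl)

theorem continuous_kernelFourier (h : IsAdmissibleKernel Φ τ c C) :
    Continuous (kernelFourier Φ) :=
  VectorFourier.fourierIntegral_continuous Real.continuous_fourierChar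
    (by exact continuous_inner) h.integrable.ofReal

/-- The upper bound decays like `‖w‖^(-2τ)` with `2τ > d`; this makes Fourier inversion available.
-/
theorem integrable_kernelFourier (h : IsAdmissibleKernel Φ τ c C) :
    Integrable (kernelFourier Φ) := by
  have hpi := Real.pi_pos
  have h1 : Integrable fun x : Pt d => (1 + ‖x‖ ^ 2) ^ (-(2 * τ) / 2) := by
    refine integrable_rpow_neg_one_add_norm_sq ?_
    rw [finrank_euclideanSpace, Fintype.card_fin]
    linarith [h.smoothness]
  have h2 := ((h1.comp_smul (by positivity : (2 * Real.pi) ≠ 0)).const_mul C).const_mul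
    ((2 * Real.pi) ^ ((d : ℝ) / 2))
  refine h2.mono' h.continuous_kernelFourier.aestronglyMeasurable
    (Filter.Eventually.of_forall fun w => ?_)
  rw [← h.ofReal_re_kernelFourier, Complex.norm_real,
    Real.norm_of_nonneg (h.re_kernelFourier_nonneg w), re_kernelFourier]
  refine mul_le_mul_of_nonneg_left ((h.upper_bound _).trans_eq ?_) (by positivity)
  congr 2
  ring

/-- Fourier inversion for the kernel. -/
theorem apply_eq_integral (h : IsAdmissibleKernel Φ τ c C) (x : Pt d) :
    (Φ x : ℂ) = ∫ w, (Real.fourierChar (inner ℝ x w) : ℂ) * kernelFourier Φ w := by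
  have hi := congrFun (Continuous.fourierInv_fourier_eq
    (Complex.continuous_ofReal.comp h.continuous) h.integrable.ofReal h.integrable_kernelFourier) x
  rw [Real.fourierInv_eq] at hi
  refine hi.symm.trans (integral_congr_ae (Filter.Eventually.of_forall fun w => ?_))
  simp only [Circle.smul_def, smul_eq_mul, real_inner_comm x w]
  rfl

theorem integrable_fourierChar_mul (h : IsAdmissibleKernel Φ τ c C) (x : Pt d) :
    Integrable fun w => (Real.fourierChar (inner ℝ x w) : ℂ) * kernelFourier Φ w := by
  refine h.integrable_kernelFourier.mono ?_ 
    (Filter.Eventually.of_forall fun w => by rw [norm_mul, Circle.norm_coe, one_mul])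
  have hc : Continuous fun w : Pt d => (Real.fourierChar (inner ℝ x w) : ℂ) :=
    continuous_subtype_val.comp (Real.continuous_fourierChar.comp (by fun_prop))
  exact (hc.mul h.continuous_kernelFourier).aestronglyMeasurable

/-- By inversion `Φ(x)` integrates `Φ̂ ≥ 0` against a unimodular factor, which equals `1` at `x =
0`. -/
theorem abs_apply_le (h : IsAdmissibleKernel Φ τ c C) (x : Pt d) : |Φ x| ≤ Φ 0 := by
  have h0 : Φ 0 = ∫ w, (kernelFourier Φ w).re := by
    have := h.apply_eq_integral 0
    simp only [inner_zero_left, AddChar.map_zero_eq_one, Circle.coe_one, one_mul] at this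
    rw [← Complex.ofReal_inj, this, ← integral_complex_ofReal]
    simp only [h.ofReal_re_kernelFourier]
  rw [h0, ← Real.norm_eq_abs, ← Complex.norm_real, h.apply_eq_integral x]
  refine (norm_integral_le_integral_norm _).trans_eq ?_
  refine integral_congr_ae (Filter.Eventually.of_forall fun w => ?_)
  simp only [norm_mul, Circle.norm_coe, one_mul]
  rw [← h.ofReal_re_kernelFourier, Complex.norm_real,
    Real.norm_of_nonneg (h.re_kernelFourier_nonneg w), Complex.ofReal_re]

theorem abs_apply_le_one (h : IsAdmissibleKernel Φ τ c C) (x : Pt d) : |Φ x| ≤ 1 :=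
  (h.abs_apply_le x).trans h.apply_zero_le_one

theorem normSq_expSum {n : ℕ} (a : Fin n → ℝ) (z : Fin n → Pt d) (w : Pt d) :
    ((‖expSum a z w‖ ^ 2 : ℝ) : ℂ) =
      ∑ i, ∑ j, ((a i * a j : ℝ) : ℂ) * (Real.fourierChar (inner ℝ (z i - z j) w) : ℂ) := by
  rw [← Complex.normSq_eq_norm_sq, Complex.normSq_eq_conj_mul_self]
  unfold expSum
  rw [map_sum, Finset.sum_mul_sum]
  refine Finset.sum_congr rfl fun i _ => Finset.sum_congr rfl fun j _ => ?_
  rw [inner_sub_left, sub_eq_add_neg, AddChar.map_add_eq_mul, Circle.coe_mul, map_mul,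
    Complex.conj_ofReal, AddChar.map_neg_eq_inv, Circle.coe_inv_eq_conj, Complex.conj_conj]
  push_cast
  ring

theorem quadForm_eq {n : ℕ} (h : IsAdmissibleKernel Φ τ c C) (a : Fin n → ℝ)
    (z : Fin n → Pt d) :
    ∑ i, ∑ j, a i * a j * Φ (z i - z j) =
      ∫ w, ‖expSum a z w‖ ^ 2 * (kernelFourier Φ w).re := by
  rw [← Complex.ofReal_inj, ← integral_complex_ofReal]
  simp only [Complex.ofReal_mul _ (Complex.re _), h.ofReal_re_kernelFourier, normSq_expSum,
    Finset.sum_mul, mul_assoc]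
  rw [integral_finsetSum _ fun i _ => integrable_finsetSum _ fun j _ =>
    (h.integrable_fourierChar_mul _).const_mul _]
  rw [Complex.ofReal_sum]
  refine Finset.sum_congr rfl fun i _ => ?_
  rw [integral_finsetSum _ fun j _ => (h.integrable_fourierChar_mul _).const_mul _,
    Complex.ofReal_sum]
  refine Finset.sum_congr rfl fun j _ => ?_
  rw [integral_const_mul, ← h.apply_eq_integral]
  push_cast
  ring

theorem integrable_norm_sq_expSum_mul {n : ℕ} (h : IsAdmissibleKernel Φ τ c C) (a : Fin n → ℝ)
    (z : Fin n → Pt d) :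
    Integrable fun w => ‖expSum a z w‖ ^ 2 * (kernelFourier Φ w).re := by
  have : Integrable fun w => ((‖expSum a z w‖ ^ 2 * (kernelFourier Φ w).re : ℝ) : ℂ) := by
    simp only [Complex.ofReal_mul _ (Complex.re _), h.ofReal_re_kernelFourier, normSq_expSum,
      Finset.sum_mul, mul_assoc]
    exact integrable_finsetSum _ fun i _ => integrable_finsetSum _ fun j _ =>
      (h.integrable_fourierChar_mul _).const_mul _
  exact this.re

/-- Lower bound for the quadratic form of the kernel matrix of `2s`-separated points. -/
theorem le_quadForm {n : ℕ} (h : IsAdmissibleKernel Φ τ c C) (hd : 1 ≤ d) (a : Fin n → ℝ)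
    {z : Fin n → Pt d} {s r : ℝ} (hs : 0 < s) (hz : ∀ i j, i ≠ j → 2 * s ≤ ‖z i - z j‖)
    (hr : 0 < r) (hrs : (d + 2 : ℝ) ≤ 2 * Real.pi * r * s) :
    (2 * Real.pi) ^ ((d : ℝ) / 2) * (c * (1 + (2 * Real.pi * r) ^ 2) ^ (-τ)) *
      ((5 / 9) / (unitBallVolume d * s ^ d)) * ∑ j, a j ^ 2 ≤
      ∑ i, ∑ j, a i * a j * Φ (z i - z j) := by
  set L := (2 * Real.pi) ^ ((d : ℝ) / 2) * (c * (1 + (2 * Real.pi * r) ^ 2) ^ (-τ)) with hL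
  have hc := h.lower_pos
  have hpi := Real.pi_pos
  have hL0 : 0 ≤ L := by positivity
  rw [h.quadForm_eq, mul_assoc]
  refine (mul_le_mul_of_nonneg_left (le_setIntegral_norm_sq_expSum hd a hs hz hr hrs) hL0).trans ?_
  rw [← integral_const_mul, ← integral_indicator Metric.isClosed_closedBall.measurableSet]
  refine integral_mono_of_nonneg (Filter.Eventually.of_forall fun w => ?_)
    (h.integrable_norm_sq_expSum_mul a z) (Filter.Eventually.of_forall fun w => ?_)
  · exact Set.indicator_nonneg (fun w _ => by positivity) w
  · have h0 := h.re_kernelFourier_nonneg w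
    by_cases hw : w ∈ Metric.closedBall (0 : Pt d) r
    · simp only [Set.indicator_of_mem hw]
      rw [mul_comm]
      exact mul_le_mul_of_nonneg_left (h.le_re_kernelFourier (by simpa using hw)) (by positivity)
    · simp only [Set.indicator_of_notMem hw]
      positivity

/-- At frequency zero the transform is `∫ Φ`, and `|Φ| ≤ 1` lives on the unit ball. This caps `c`,
as needed when the matrix is diagonal. -/
theorem lower_le (h : IsAdmissibleKernel Φ τ c C) :
    (2 * Real.pi) ^ ((d : ℝ) / 2) * c ≤ unitBallVolume d := by
  have h1 := h.le_re_kernelFourier (r := 0) (w := 0) (by simp)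
  simp only [mul_zero, ne_eq, OfNat.ofNat_ne_zero, not_false_eq_true, zero_pow, add_zero,
    Real.one_rpow, mul_one] at h1
  refine h1.trans ((Complex.re_le_norm _).trans ?_)
  refine (VectorFourier.norm_fourierIntegral_le_integral_norm _ _ _ _ _).trans ?_
  calc ∫ x, ‖(Φ x : ℂ)‖ ≤ ∫ x, (Metric.closedBall (0 : Pt d) 1).indicator (fun _ => (1 : ℝ)) x := by
        refine integral_mono_of_nonneg (Filter.Eventually.of_forall fun x => norm_nonneg _) ?_
          (Filter.Eventually.of_forall fun x => ?_)
        · rw [integrable_indicator_iff Metric.isClosed_closedBall.measurableSet]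
          exact continuousOn_const.integrableOn_compact (isCompact_closedBall 0 1)
        · simp only [Complex.norm_real, Real.norm_eq_abs]
          by_cases hx : x ∈ Metric.closedBall (0 : Pt d) 1
          · rw [Set.indicator_of_mem hx]
            exact h.abs_apply_le_one x
          · rw [Set.indicator_of_notMem hx, h.eq_zero_of_one_lt_norm (by simpa using hx), abs_zero]
    _ = unitBallVolume d := by
        rw [integral_indicator_const _ Metric.isClosed_closedBall.measurableSet, smul_eq_mul,
          mul_one, measureReal_def, Measure.addHaar_unitClosedBall_eq_addHaar_unitBall]
        rfl

end IsAdmissibleKernel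

/-! ### Operator norm and condition number bounds -/

/-- Schur's test for a symmetric matrix. -/
theorem opNorm₂_le_of_row_sum_le {n : ℕ} {A : Matrix (Fin n) (Fin n) ℝ} (hA : A.IsSymm) {R : ℝ}
    (hR : 0 ≤ R) (h : ∀ i, ∑ j, |A i j| ≤ R) : opNorm₂ A ≤ R := by
  refine ContinuousLinearMap.opNorm_le_bound _ hR fun v => ?_
  refine le_of_sq_le_sq ?_ (by positivity)
  rw [mul_pow, EuclideanSpace.real_norm_sq_eq, EuclideanSpace.real_norm_sq_eq]
  have h1 : ∀ i, (Matrix.toEuclideanCLM (𝕜 := ℝ) A v) i ^ 2 ≤ R * ∑ j, |A i j| * v j ^ 2 := by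
    intro i
    have e : (Matrix.toEuclideanCLM (𝕜 := ℝ) A v) i = ∑ j, A i j * v j := by
      simp [Matrix.mulVec, dotProduct]
    rw [e]
    have h2 : |∑ j, A i j * v j| ≤ ∑ j, |A i j| * |v j| := by
      refine (Finset.abs_sum_le_sum_abs _ _).trans_eq ?_
      simp only [abs_mul]
    -- Cauchy–Schwarz after splitting `|A i j|` into two square roots.
    have h3 : (∑ j, |A i j| * |v j|) ^ 2 ≤ (∑ j, |A i j|) * ∑ j, |A i j| * v j ^ 2 := by
      refine Finset.sum_sq_le_sum_mul_sum_of_sq_le_mul _ (fun j _ => abs_nonneg _)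
        (fun j _ => by positivity) fun j _ => ?_
      rw [mul_pow, sq_abs (v j)]
      exact le_of_eq (by ring)
    calc (∑ j, A i j * v j) ^ 2 = |∑ j, A i j * v j| ^ 2 := (sq_abs _).symm
      _ ≤ (∑ j, |A i j| * |v j|) ^ 2 := by gcongr
      _ ≤ _ := h3
      _ ≤ _ := by
        refine mul_le_mul_of_nonneg_right (h i) (Finset.sum_nonneg fun j _ => by positivity)
  calc ∑ i, (Matrix.toEuclideanCLM (𝕜 := ℝ) A v) i ^ 2
      ≤ ∑ i, R * ∑ j, |A i j| * v j ^ 2 := Finset.sum_le_sum fun i _ => h1 i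
    _ = R * ∑ j, (∑ i, |A j i|) * v j ^ 2 := by
        rw [← Finset.mul_sum, Finset.sum_comm]
        congr 1
        refine Finset.sum_congr rfl fun j _ => ?_
        rw [Finset.sum_mul]
        refine Finset.sum_congr rfl fun i _ => ?_
        rw [hA.apply]
    _ ≤ R * ∑ j, R * v j ^ 2 := by
        gcongr with j _
        exact h j
    _ = R ^ 2 * ∑ j, v j ^ 2 := by
        rw [← Finset.mul_sum]
        ring

theorem isUnit_of_le_quadForm {n : ℕ} {A : Matrix (Fin n) (Fin n) ℝ} {μ : ℝ} (hμ : 0 < μ)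
    (h : ∀ a : Fin n → ℝ, μ * ∑ j, a j ^ 2 ≤ ∑ i, ∑ j, a i * a j * A i j) : IsUnit A := by
  rw [← Matrix.mulVec_injective_iff_isUnit]
  refine (injective_iff_map_eq_zero (Matrix.mulVecLin A)).2 fun a ha => ?_
  have h1 := h a
  have h2 : ∑ i, ∑ j, a i * a j * A i j = 0 := by
    refine Finset.sum_eq_zero fun i _ => ?_
    have := congrFun ha i
    simp only [Matrix.mulVecLin_apply, Matrix.mulVec, dotProduct, Pi.zero_apply] at this
    calc ∑ j, a i * a j * A i j = a i * ∑ j, A i j * a j := by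
          rw [Finset.mul_sum]
          exact Finset.sum_congr rfl fun j _ => by ring
      _ = 0 := by rw [this, mul_zero]
  have h3 : ∑ j, a j ^ 2 = 0 := by
    refine le_antisymm ?_ (Finset.sum_nonneg fun j _ => sq_nonneg _)
    nlinarith
  ext j
  have := (Finset.sum_eq_zero_iff_of_nonneg fun j _ => sq_nonneg (a j)).1 h3 j (Finset.mem_univ j)
  simpa using this

/-- Coercivity: for `x = A⁻¹ y`, `μ‖x‖² ≤ ⟨x, Ax⟩ = ⟨x, y⟩ ≤ ‖x‖‖y‖`. No spectral theory is
required. -/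
theorem opNorm₂_inv_le_of_le_quadForm {n : ℕ} {A : Matrix (Fin n) (Fin n) ℝ} {μ : ℝ} (hμ : 0 < μ)
    (h : ∀ a : Fin n → ℝ, μ * ∑ j, a j ^ 2 ≤ ∑ i, ∑ j, a i * a j * A i j) :
    opNorm₂ A⁻¹ ≤ μ⁻¹ := by
  have hu := isUnit_of_le_quadForm hμ h
  refine ContinuousLinearMap.opNorm_le_bound _ (by positivity) fun y => ?_
  set x := Matrix.toEuclideanCLM (𝕜 := ℝ) A⁻¹ y with hx
  have hAx : Matrix.toEuclideanCLM (𝕜 := ℝ) A x = y := by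
    rw [hx, ← mul_apply_eq_comp, ← map_mul,
      Matrix.mul_nonsing_inv _ ((Matrix.isUnit_iff_isUnit_det A).1 hu), map_one]
    rfl
  have h1 := h x
  have h2 : ∑ i, ∑ j, x i * x j * A i j = inner ℝ x y := by
    rw [← hAx]
    simp only [PiLp.inner_apply, RCLike.inner_apply, conj_trivial, Matrix.ofLp_toEuclideanCLM,
      Matrix.mulVec, dotProduct]
    refine Finset.sum_congr rfl fun i _ => ?_
    rw [Finset.sum_mul]
    exact Finset.sum_congr rfl fun j _ => by ring
  rw [h2, ← EuclideanSpace.real_norm_sq_eq] at h1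
  have h3 : μ * ‖x‖ ^ 2 ≤ ‖x‖ * ‖y‖ := h1.trans (real_inner_le_norm x y)
  rw [← div_eq_inv_mul, le_div_iff₀ hμ]
  rcases (norm_nonneg x).eq_or_lt with h0 | h0
  · rw [← h0, zero_mul]
    exact norm_nonneg y
  · refine le_of_mul_le_mul_left ?_ h0
    linarith

theorem cond₂_le {n : ℕ} {A : Matrix (Fin n) (Fin n) ℝ} (hA : A.IsSymm) {μ R : ℝ} (hμ : 0 < μ)
    (hR : 0 ≤ R) (hrow : ∀ i, ∑ j, |A i j| ≤ R)
    (h : ∀ a : Fin n → ℝ, μ * ∑ j, a j ^ 2 ≤ ∑ i, ∑ j, a i * a j * A i j) :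
    cond₂ A ≤ R / μ := by
  rw [cond₂, div_eq_mul_inv]
  exact mul_le_mul (opNorm₂_le_of_row_sum_le hA hR hrow) (opNorm₂_inv_le_of_le_quadForm hμ h)
    (norm_nonneg _) hR

/-! ### Packing of separated nodes -/

/-- Packing bound: a ball of radius `1` around a node contains at most `((1 + ρ) / ρ)^d` nodes of
a `2ρ`-separated set. -/
theorem card_near_le {d n : ℕ} {z : Fin n → Pt d} {ρ : ℝ} (hρ : 0 < ρ)
    (hz : ∀ i j, i ≠ j → 2 * ρ ≤ ‖z i - z j‖) (i : Fin n) :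
    ((Finset.univ.filter fun j => ‖z i - z j‖ ≤ 1).card : ℝ) ≤ ((1 + ρ) / ρ) ^ d := by
  set T := Finset.univ.filter fun j => ‖z i - z j‖ ≤ 1 with hT
  have hV : 0 < unitBallVolume d := unitBallVolume_pos
  have hball : ∀ (x : Pt d) {r : ℝ}, 0 < r →
      volume.real (Metric.ball x r) = r ^ d * unitBallVolume d := by
    intro x r hr
    rw [measureReal_def, Measure.addHaar_ball_of_pos _ _ hr, ENNReal.toReal_mul,
      ENNReal.toReal_ofReal (by positivity), finrank_euclideanSpace, Fintype.card_fin]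
    rfl
  have hdisj : Set.PairwiseDisjoint (T : Set (Fin n)) fun j => Metric.ball (z j) ρ := by
    intro j _ k _ hjk
    refine Metric.ball_disjoint_ball ?_
    rw [dist_eq_norm]
    linarith [hz j k hjk]
  have hsub : (⋃ j ∈ T, Metric.ball (z j) ρ) ⊆ Metric.ball (z i) (1 + ρ) := by
    refine Set.iUnion₂_subset fun j hj => Metric.ball_subset_ball' ?_
    have : ‖z i - z j‖ ≤ 1 := (Finset.mem_filter.1 hj).2
    rw [dist_comm, dist_eq_norm]
    linarith
  have h1 := measureReal_mono (μ := volume) hsub measure_ball_lt_top.ne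
  rw [measureReal_biUnion_finset hdisj (fun j _ => measurableSet_ball)
    (fun j _ => measure_ball_lt_top.ne)] at h1
  simp only [hball _ hρ, hball _ (by positivity : 0 < 1 + ρ), Finset.sum_const, nsmul_eq_mul] at h1
  rw [div_pow, le_div_iff₀ (by positivity)]
  refine le_of_mul_le_mul_right ?_ hV
  linarith

/-! ### Estimates for the constants `M_d` and `C_d` -/

/-- The base of the power `constM`. -/
def packingBase (d : ℕ) : ℝ := constM d / 12

theorem Gamma_pos (d : ℕ) : 0 < Real.Gamma ((d : ℝ) / 2 + 1) :=
  Real.Gamma_pos_of_pos (by positivity)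

theorem packingBase_pow (d : ℕ) :
    packingBase d ^ (d + 1) = Real.pi * Real.Gamma ((d : ℝ) / 2 + 1) ^ 2 / 9 := by
  have hG := Gamma_pos d
  have hpi := Real.pi_pos
  rw [packingBase, constM, mul_div_cancel_left₀ _ (by norm_num), ← Real.rpow_natCast,
    ← Real.rpow_mul (by positivity)]
  push_cast
  rw [one_div, inv_mul_cancel₀ (by positivity), Real.rpow_one]

theorem packingBase_pos (d : ℕ) : 0 < packingBase d := by
  have hG := Gamma_pos d
  have hpi := Real.pi_pos
  rw [packingBase, constM]
  positivity

/-- `(1 + 2/(d+2))^(d+2) ≤ e² ≤ 8`, and the one remaining factor is at most `2`. -/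
theorem add_four_pow_le {d : ℕ} (hd : 1 ≤ d) :
    ((d : ℝ) + 4) ^ (d + 3) ≤ 16 * ((d : ℝ) + 2) ^ (d + 3) := by
  have hd' : (1 : ℝ) ≤ d := by exact_mod_cast hd
  have h1 : ((d : ℝ) + 4) / (d + 2) ≤ Real.exp (2 / (d + 2)) := by
    have := Real.add_one_le_exp (2 / ((d : ℝ) + 2))
    refine le_trans (le_of_eq ?_) this
    field_simp
    ring
  have h2 : (((d : ℝ) + 4) / (d + 2)) ^ (d + 2) ≤ 8 := by
    calc (((d : ℝ) + 4) / (d + 2)) ^ (d + 2) ≤ Real.exp (2 / (d + 2)) ^ (d + 2) := by gcongr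
      _ = Real.exp 1 ^ 2 := by
        rw [← Real.exp_nat_mul, ← Real.exp_nat_mul]
        congr 1
        push_cast
        field_simp
      _ ≤ 8 := by nlinarith [Real.exp_one_lt_d9, Real.exp_pos 1]
  have h3 : ((d : ℝ) + 4) / (d + 2) ≤ 2 := by
    rw [div_le_iff₀ (by positivity)]
    linarith
  have h4 : (((d : ℝ) + 4) / (d + 2)) ^ (d + 3) ≤ 16 := by
    rw [pow_succ]
    calc _ ≤ (8 : ℝ) * 2 := by gcongr
      _ = 16 := by norm_num
  rwa [div_pow, div_le_iff₀ (by positivity)] at h4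

/-- Induction in steps of two, since `Γ(d/2 + 1)` then gains the factor `d/2 + 1`; the right side
grows by `64 (d/2 + 1)² = 16 (d+2)²`, just what `add_four_pow_le` absorbs. -/
theorem nine_mul_add_two_pow_le (d : ℕ) (hd : 1 ≤ d) :
    9 * ((d : ℝ) + 2) ^ (d + 1) ≤
      8 ^ (d + 1) * (Real.pi * Real.Gamma ((d : ℝ) / 2 + 1) ^ 2) := by
  have hpi := Real.pi_gt_d2
  induction d using Nat.twoStepInduction with
  | zero => omega
  | one =>
    have : Real.Gamma ((1 : ℕ) / 2 + 1) = Real.sqrt Real.pi / 2 := by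
      rw [Real.Gamma_add_one (by norm_num), Nat.cast_one, Real.Gamma_one_half_eq]
      ring
    rw [this, div_pow, Real.sq_sqrt Real.pi_pos.le]
    norm_num
    nlinarith
  | more d ih _ =>
    rcases Nat.eq_zero_or_pos d with rfl | hd0
    · norm_num
      linarith
    · have h := ih hd0
      have hG : Real.Gamma (((d + 2 : ℕ) : ℝ) / 2 + 1) =
          ((d : ℝ) / 2 + 1) * Real.Gamma ((d : ℝ) / 2 + 1) := by
        rw [← Real.Gamma_add_one (by positivity)]
        congr 1
        push_cast
        ring
      rw [hG]
      push_cast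
      calc 9 * ((d : ℝ) + 2 + 2) ^ (d + 2 + 1) = 9 * ((d : ℝ) + 4) ^ (d + 3) := by ring_nf
        _ ≤ 9 * (16 * ((d : ℝ) + 2) ^ (d + 3)) := by gcongr; exact add_four_pow_le hd0
        _ = 16 * ((d : ℝ) + 2) ^ 2 * (9 * ((d : ℝ) + 2) ^ (d + 1)) := by ring
        _ ≤ 16 * ((d : ℝ) + 2) ^ 2 *
            (8 ^ (d + 1) * (Real.pi * Real.Gamma ((d : ℝ) / 2 + 1) ^ 2)) := by gcongr
        _ = _ := by ring

theorem add_two_le_packingBase {d : ℕ} (hd : 1 ≤ d) : (d : ℝ) + 2 ≤ 8 * packingBase d := by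
  have hp := packingBase_pos d
  refine le_of_pow_le_pow_left₀ (n := d + 1) (by omega) (by positivity) ?_
  rw [mul_pow, packingBase_pow]
  linarith [nine_mul_add_two_pow_le d hd]

theorem rpow_half_eq (d : ℕ) :
    (2 * Real.pi) ^ ((d : ℝ) / 2) = Real.sqrt 2 ^ d * Real.sqrt Real.pi ^ d := by
  have hpi := Real.pi_pos
  rw [← mul_pow, ← Real.sqrt_mul (by norm_num), Real.sqrt_eq_rpow, ← Real.rpow_natCast,
    ← Real.rpow_mul (by positivity)]
  congr 1
  ring

theorem constC_eq (d : ℕ) :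
    constC d = 1 / (2 * Real.Gamma ((d : ℝ) / 2 + 1)) * (3 * Real.sqrt 2 * packingBase d) ^ d := by
  have h : (2 : ℝ) ^ ((3 : ℝ) / 2) = 2 * Real.sqrt 2 := by
    rw [show (3 : ℝ) / 2 = 1 + 1 / 2 by norm_num, Real.rpow_add (by norm_num), Real.rpow_one,
      Real.sqrt_eq_rpow]
  have h2 : Real.sqrt 2 ^ 2 = 2 := Real.sq_sqrt (by norm_num)
  rw [constC, h, packingBase]
  congr 2
  field_simp
  rw [h2]
  ring

theorem constC_pos (d : ℕ) : 0 < constC d := by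
  have hp := packingBase_pos d
  have hG := Gamma_pos d
  rw [constC_eq]
  positivity

theorem Gamma_sq_eq (d : ℕ) :
    Real.Gamma ((d : ℝ) / 2 + 1) ^ 2 = 9 * packingBase d ^ (d + 1) / Real.pi := by
  have hpi := Real.pi_pos
  rw [packingBase_pow]
  field_simp

/-- With `p = packingBase d` and `Γ² = 9 p^(d+1) / π`, common factors cancel and `π ≤ 10 p` remains.
-/
theorem constC_le {d : ℕ} (hd : 1 ≤ d) :
    constC d ≤ (2 * Real.pi) ^ ((d : ℝ) / 2) * ((5 / 9) / (unitBallVolume d * (1 / 3) ^ d)) := by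
  have hp := packingBase_pos d
  have hG := Gamma_pos d
  have hpi := Real.pi_pos
  have hd' : (1 : ℝ) ≤ d := by exact_mod_cast hd
  have hp' : 3 / 8 ≤ packingBase d := by linarith [add_two_le_packingBase hd]
  have e : (2 * Real.pi) ^ ((d : ℝ) / 2) * ((5 / 9) / (unitBallVolume d * (1 / 3) ^ d)) =
      Real.sqrt 2 ^ d * 3 ^ d * (1 / (2 * Real.Gamma ((d : ℝ) / 2 + 1))) *
        (10 / 9 * Real.Gamma ((d : ℝ) / 2 + 1) ^ 2) := by
    rw [rpow_half_eq, unitBallVolume_eq, one_div_pow]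
    field_simp
    norm_num
  rw [e, constC_eq, mul_pow, mul_pow, Gamma_sq_eq]
  have h1 : packingBase d ^ d ≤ 10 / 9 * (9 * packingBase d ^ (d + 1) / Real.pi) := by
    rw [pow_succ, ← mul_div_assoc, le_div_iff₀ hpi]
    have : Real.pi ≤ 10 * packingBase d := by linarith [Real.pi_lt_d2]
    nlinarith [mul_le_mul_of_nonneg_left this (by positivity : 0 ≤ packingBase d ^ d)]
  calc _ = Real.sqrt 2 ^ d * 3 ^ d * (1 / (2 * Real.Gamma ((d : ℝ) / 2 + 1))) *
        packingBase d ^ d := by ring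
    _ ≤ _ := by gcongr

/-- The same cancellation reduces this to `3^d ≤ 4^d` and `π ≤ 18 p`. -/
theorem constC_mul_unitBallVolume_le {d : ℕ} (hd : 1 ≤ d) :
    constC d * unitBallVolume d ≤ 4 ^ d * (2 * Real.pi) ^ ((d : ℝ) / 2) := by
  have hp := packingBase_pos d
  have hG := Gamma_pos d
  have hpi := Real.pi_pos
  have hd' : (1 : ℝ) ≤ d := by exact_mod_cast hd
  have hp' : 3 / 8 ≤ packingBase d := by linarith [add_two_le_packingBase hd]
  have h1 : (3 * packingBase d) ^ d ≤ 4 ^ d * (2 * Real.Gamma ((d : ℝ) / 2 + 1) ^ 2) := by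
    rw [Gamma_sq_eq, mul_pow]
    have h2 : packingBase d ^ d ≤ 2 * (9 * packingBase d ^ (d + 1) / Real.pi) := by
      rw [pow_succ, ← mul_div_assoc, le_div_iff₀ hpi]
      have : Real.pi ≤ 18 * packingBase d := by linarith [Real.pi_lt_d2]
      nlinarith [mul_le_mul_of_nonneg_left this (by positivity : 0 ≤ packingBase d ^ d)]
    gcongr
    norm_num
  have e : constC d * unitBallVolume d = Real.sqrt 2 ^ d * Real.sqrt Real.pi ^ d *
      ((3 * packingBase d) ^ d / (2 * Real.Gamma ((d : ℝ) / 2 + 1) ^ 2)) := by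
    rw [constC_eq, unitBallVolume_eq]
    field_simp
    ring
  rw [e, rpow_half_eq, mul_comm ((4 : ℝ) ^ d)]
  gcongr
  rwa [div_le_iff₀ (by positivity)]

/-! ### Separation distance and the scaled kernel matrix -/

theorem separationDistance_pos {d n : ℕ} {X : Fin n → Pt d} (hn : 2 ≤ n)
    (hX : Function.Injective X) : 0 < separationDistance X := by
  set T : Set ℝ := {r : ℝ | ∃ j k : Fin n, j ≠ k ∧ r = ‖X j - X k‖} with hT
  have hfin : T.Finite := by
    refine (Set.finite_range fun p : Fin n × Fin n => ‖X p.1 - X p.2‖).subset ?_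
    rintro r ⟨j, k, _, rfl⟩
    exact ⟨(j, k), rfl⟩
  have hne : T.Nonempty :=
    ⟨_, ⟨0, by omega⟩, ⟨1, by omega⟩, by simp, rfl⟩
  obtain ⟨j, k, hjk, h⟩ := hne.csInf_mem hfin
  rw [separationDistance, ← hT, h]
  have : 0 < ‖X j - X k‖ := norm_pos_iff.2 (sub_ne_zero.2 fun e => hjk (hX e))
  positivity

theorem two_mul_separationDistance_le {d n : ℕ} (X : Fin n → Pt d) {j k : Fin n} (hjk : j ≠ k) :
    2 * separationDistance X ≤ ‖X j - X k‖ := by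
  have : sInf {r : ℝ | ∃ j k : Fin n, j ≠ k ∧ r = ‖X j - X k‖} ≤ ‖X j - X k‖ :=
    csInf_le ⟨0, by rintro r ⟨j, k, _, rfl⟩; exact norm_nonneg _⟩ ⟨j, k, hjk, rfl⟩
  rw [separationDistance]
  linarith

theorem kernelMatrix_apply {d n : ℕ} (Φ : Pt d → ℝ) (δ : ℝ) (X : Fin n → Pt d) (i j : Fin n) :
    kernelMatrix Φ δ X i j = (δ ^ d)⁻¹ * Φ (δ⁻¹ • X i - δ⁻¹ • X j) := by
  simp [kernelMatrix, scaledKernel, smul_sub]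

namespace IsAdmissibleKernel

variable {d : ℕ} {Φ : Pt d → ℝ} {τ c C : ℝ}

theorem kernelMatrix_isSymm {n : ℕ} (h : IsAdmissibleKernel Φ τ c C) (δ : ℝ)
    (X : Fin n → Pt d) : (kernelMatrix Φ δ X).IsSymm := by
  ext i j
  rw [Matrix.transpose_apply, kernelMatrix_apply, kernelMatrix_apply, ← h.apply_neg, neg_sub]

/-- The quadratic form of the kernel matrix of `2q`-separated points is bounded below, uniformly in
the number of points. -/
theorem le_quadForm_kernelMatrix {n : ℕ} (h : IsAdmissibleKernel Φ τ c C) (hd : 1 ≤ d)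
    {δ q : ℝ} (hδ : 0 < δ) (hq : 0 < q) {X : Fin n → Pt d}
    (hX : ∀ i j, i ≠ j → 2 * q ≤ ‖X i - X j‖) (a : Fin n → ℝ) :
    constC d * c * (q ^ d)⁻¹ * (1 + 4 * constM d ^ 2 * (δ / q) ^ 2) ^ (-τ) * ∑ j, a j ^ 2 ≤
      ∑ i, ∑ j, a i * a j * kernelMatrix Φ δ X i j := by
  have hc := h.lower_pos
  have hpi := Real.pi_pos
  have hp := packingBase_pos d
  have hM : constM d = 12 * packingBase d := by rw [packingBase]; ring
  have hz : ∀ i j, i ≠ j → 2 * (q / δ / 3) ≤ ‖δ⁻¹ • X i - δ⁻¹ • X j‖ := by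
    intro i j hij
    rw [← smul_sub, norm_smul, norm_inv, Real.norm_of_nonneg hδ.le, ← div_eq_inv_mul,
      le_div_iff₀ hδ]
    have := hX i j hij
    have e : 2 * (q / δ / 3) * δ = 2 * q / 3 := by field_simp
    rw [e]
    linarith
  -- The radius `r` is chosen so that `(2πr)² = 4 M_d² (δ/q)²`. Taking a third of the available
  -- separation gains `3^d` in the energy bound, as `constC_le` needs, and still `2πrs = 8 p ≥ d +
  -- 2`.
  have h1 := h.le_quadForm hd a (s := q / δ / 3) (r := constM d * (δ / q) / Real.pi)
    (z := fun j => δ⁻¹ • X j) (by positivity) hz (by rw [hM]; positivity) (by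
      have e : 2 * Real.pi * (constM d * (δ / q) / Real.pi) * (q / δ / 3) =
          8 * packingBase d := by
        rw [hM]
        field_simp
        norm_num
      rw [e]
      exact add_two_le_packingBase hd)
  have e1 : (2 * Real.pi * (constM d * (δ / q) / Real.pi)) ^ 2 =
      4 * constM d ^ 2 * (δ / q) ^ 2 := by
    field_simp
    ring
  rw [e1] at h1
  set P := (1 + 4 * constM d ^ 2 * (δ / q) ^ 2) ^ (-τ) with hP
  have hP0 : 0 ≤ P := by positivity
  have hV := unitBallVolume_pos (d := d)
  have h2 : ∑ i, ∑ j, a i * a j * kernelMatrix Φ δ X i j =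
      (δ ^ d)⁻¹ * ∑ i, ∑ j, a i * a j * Φ (δ⁻¹ • X i - δ⁻¹ • X j) := by
    simp only [kernelMatrix_apply, Finset.mul_sum]
    exact Finset.sum_congr rfl fun i _ => Finset.sum_congr rfl fun j _ => by ring
  have hS : 0 ≤ ∑ j, a j ^ 2 := Finset.sum_nonneg fun j _ => sq_nonneg _
  rw [h2]
  refine le_trans ?_ (mul_le_mul_of_nonneg_left h1 (by positivity))
  rw [← mul_assoc]
  refine mul_le_mul_of_nonneg_right ?_ hS
  calc constC d * c * (q ^ d)⁻¹ * P ≤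
      (2 * Real.pi) ^ ((d : ℝ) / 2) * ((5 / 9) / (unitBallVolume d * (1 / 3) ^ d)) * c *
        (q ^ d)⁻¹ * P := by
        gcongr
        exact constC_le hd
    _ = _ := by
        have e2 : (q / δ / 3) ^ d = q ^ d * (δ ^ d)⁻¹ * (1 / 3) ^ d := by
          rw [← inv_pow, ← mul_pow, ← mul_pow]
          congr 1
          ring
        rw [e2]
        field_simp

/-- The quadratic form bound for a single node, where separation is vacuous. -/
theorem apply_zero_pos (h : IsAdmissibleKernel Φ τ c C) (hd : 1 ≤ d) : 0 < Φ 0 := by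
  have hc := h.lower_pos
  have hC := constC_pos d
  have h1 := h.le_quadForm_kernelMatrix hd (n := 1) one_pos one_pos (X := fun _ => 0)
    (fun i j hij => absurd (Subsingleton.elim i j) hij) fun _ => 1
  simp only [kernelMatrix_apply, Finset.sum_const, Finset.card_univ, Fintype.card_fin] at h1
  simp only [one_pow, inv_one, one_smul, sub_self, one_mul] at h1
  refine lt_of_lt_of_le ?_ h1
  positivity

theorem constC_mul_lower_le (h : IsAdmissibleKernel Φ τ c C) (hd : 1 ≤ d) :
    constC d * c ≤ 4 ^ d := by
  have hpi := Real.pi_pos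
  have h1 := h.lower_le
  have h2 := constC_mul_unitBallVolume_le hd
  have hC := constC_pos d
  have h3 := mul_le_mul_of_nonneg_left h1 hC.le
  refine le_of_mul_le_mul_right ?_ (by positivity : 0 < (2 * Real.pi) ^ ((d : ℝ) / 2))
  linarith

theorem isUnit_kernelMatrix {n : ℕ} (h : IsAdmissibleKernel Φ τ c C) (hd : 1 ≤ d)
    {δ q : ℝ} (hδ : 0 < δ) (hq : 0 < q) {X : Fin n → Pt d}
    (hX : ∀ i j, i ≠ j → 2 * q ≤ ‖X i - X j‖) : IsUnit (kernelMatrix Φ δ X) := by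
  have hc := h.lower_pos
  have hC := constC_pos d
  exact isUnit_of_le_quadForm (by positivity) (h.le_quadForm_kernelMatrix hd hδ hq hX)

/-- The condition number when the support radius is comparable to the separation distance. -/
theorem cond₂_kernelMatrix_le_of_le {n : ℕ} (h : IsAdmissibleKernel Φ τ c C) (hd : 1 ≤ d)
    {δ q : ℝ} (hδ : 0 < δ) (hq : 0 < q) {X : Fin n → Pt d}
    (hX : ∀ i j, i ≠ j → 2 * q ≤ ‖X i - X j‖) (hqδ : q ≤ 3 * δ) :
    cond₂ (kernelMatrix Φ δ X) ≤
      4 ^ d * (constC d * c)⁻¹ * (1 + 4 * constM d ^ 2 * (δ / q) ^ 2) ^ τ := by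
  have hc := h.lower_pos
  have hC := constC_pos d
  have hz : ∀ i j, i ≠ j → 2 * (q / δ) ≤ ‖δ⁻¹ • X i - δ⁻¹ • X j‖ := by
    intro i j hij
    rw [← smul_sub, norm_smul, norm_inv, Real.norm_of_nonneg hδ.le, ← div_eq_inv_mul,
      ← mul_div_assoc]
    exact div_le_div_of_nonneg_right (hX i j hij) hδ.le
  have hrow : ∀ i, ∑ j, |kernelMatrix Φ δ X i j| ≤ (δ ^ d)⁻¹ * ((1 + q / δ) / (q / δ)) ^ d := by
    intro i
    have h1 : ∀ j, |kernelMatrix Φ δ X i j| ≤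
        if ‖δ⁻¹ • X i - δ⁻¹ • X j‖ ≤ 1 then (δ ^ d)⁻¹ else 0 := by
      intro j
      rw [kernelMatrix_apply, abs_mul, abs_of_pos (by positivity : 0 < (δ ^ d)⁻¹)]
      split_ifs with hn
      · exact mul_le_of_le_one_right (by positivity) (h.abs_apply_le_one _)
      · rw [h.eq_zero_of_one_lt_norm (not_le.1 hn), abs_zero, mul_zero]
    refine (Finset.sum_le_sum fun j _ => h1 j).trans ?_
    rw [← Finset.sum_filter, Finset.sum_const, nsmul_eq_mul, mul_comm]
    exact mul_le_mul_of_nonneg_left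
      (card_near_le (z := fun j => δ⁻¹ • X j) (by positivity) hz i) (by positivity)
  refine (cond₂_le (h.kernelMatrix_isSymm δ X) (by positivity) (by positivity) hrow
    (h.le_quadForm_kernelMatrix hd hδ hq hX)).trans ?_
  -- The powers of `δ` cancel, leaving `((1 + q/δ)/q)^d`; the `4` is `1 + 3`.
  have h4 : ((δ ^ d)⁻¹ * ((1 + q / δ) / (q / δ)) ^ d) ≤ 4 ^ d * (q ^ d)⁻¹ := by
    rw [← inv_pow, ← inv_pow, ← mul_pow, ← mul_pow]
    have e : δ⁻¹ * ((1 + q / δ) / (q / δ)) = (1 + q / δ) * q⁻¹ := by field_simp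
    rw [e]
    have : q / δ ≤ 3 := by rwa [div_le_iff₀ hδ]
    gcongr
    linarith
  rw [Real.rpow_neg (by positivity)]
  have hP : 0 < (1 + 4 * constM d ^ 2 * (δ / q) ^ 2) ^ τ := by positivity
  rw [div_le_iff₀ (by positivity)]
  refine h4.trans_eq ?_
  field_simp

/-- The condition number when the support radius is below the separation distance: the matrix is
then a multiple of the identity. -/
theorem cond₂_kernelMatrix_le_one {n : ℕ} (h : IsAdmissibleKernel Φ τ c C) (hd : 1 ≤ d)
    {δ q : ℝ} (hδ : 0 < δ) {X : Fin n → Pt d}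
    (hX : ∀ i j, i ≠ j → 2 * q ≤ ‖X i - X j‖) (hqδ : δ < 2 * q) :
    cond₂ (kernelMatrix Φ δ X) ≤ 1 := by
  have h0 := h.apply_zero_pos hd
  have hpos : 0 < (δ ^ d)⁻¹ * Φ 0 := by positivity
  have hoff : ∀ i j, i ≠ j → kernelMatrix Φ δ X i j = 0 := by
    intro i j hij
    rw [kernelMatrix_apply, h.eq_zero_of_one_lt_norm, mul_zero]
    rw [← smul_sub, norm_smul, norm_inv, Real.norm_of_nonneg hδ.le, ← div_eq_inv_mul,
      one_lt_div hδ]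
    exact hqδ.trans_le (hX i j hij)
  have hdiag : ∀ i, kernelMatrix Φ δ X i i = (δ ^ d)⁻¹ * Φ 0 := by
    intro i
    rw [kernelMatrix_apply, sub_self]
  refine (cond₂_le (h.kernelMatrix_isSymm δ X) hpos hpos.le (fun i => ?_) fun a => ?_).trans_eq
    (div_self hpos.ne')
  · rw [Finset.sum_eq_single i (fun j _ hj => by rw [hoff i j hj.symm, abs_zero]) (by simp),
      hdiag, abs_of_pos hpos]
  · rw [Finset.mul_sum]
    refine Finset.sum_le_sum fun i _ => ?_
    rw [Finset.sum_eq_single i (fun j _ hj => by rw [hoff i j hj.symm, mul_zero]) (by simp),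
      hdiag]
    exact le_of_eq (by ring)

end IsAdmissibleKernel

end MultiscaleRBF

end

theorem lemma3p1 (d : ℕ) (hd : 1 ≤ d) (Φ : MultiscaleRBF.Pt d → ℝ) (τ cΦ CΦ : ℝ)
    (hΦ : MultiscaleRBF.IsAdmissibleKernel Φ τ cΦ CΦ)
    (Ω : Set (MultiscaleRBF.Pt d)) (N : ℕ → ℕ)
    (X : ∀ ℓ : ℕ, Fin (N ℓ) → MultiscaleRBF.Pt d) (cq : ℝ)
    (hX : MultiscaleRBF.IsQuasiUniformFamily Ω N X cq)
    (ν : ℝ) (hν : 0 < ν) (ℓ : ℕ) (hℓ : 1 ≤ ℓ) :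
    IsUnit (MultiscaleRBF.levelMatrix Φ Ω X ν ℓ) ∧
      MultiscaleRBF.cond₂ (MultiscaleRBF.levelMatrix Φ Ω X ν ℓ) ≤
        4 ^ d * (MultiscaleRBF.constC d * cΦ)⁻¹ *
          (1 + 4 * MultiscaleRBF.constM d ^ 2 * ν ^ 2 * cq ^ 2) ^ τ := by
  have hc := hΦ.lower_pos
  have hC := MultiscaleRBF.constC_pos d
  have hτ := hΦ.tau_pos
  have hq := MultiscaleRBF.separationDistance_pos (hX.two_le ℓ hℓ) (hX.injective ℓ hℓ)
  have hqh := hX.separation_le_fill ℓ hℓ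
  have hhq := hX.fill_le_separation ℓ hℓ
  have hsep := fun i j => MultiscaleRBF.two_mul_separationDistance_le (X ℓ) (j := i) (k := j)
  rw [MultiscaleRBF.levelMatrix]
  set q := MultiscaleRBF.separationDistance (X ℓ)
  set η := MultiscaleRBF.fillDistance Ω (X ℓ)
  have hδ : 0 < ν * η := mul_pos hν (hq.trans_le hqh)
  refine ⟨hΦ.isUnit_kernelMatrix hd hδ hq hsep, ?_⟩
  -- Beyond the threshold `3`, which gives `4^d` in the first case, `δ < q/3 < 2q` and all
  -- off-diagonal entries vanish.
  rcases le_or_gt q (3 * (ν * η)) with h | h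
  · refine (hΦ.cond₂_kernelMatrix_le_of_le hd hδ hq hsep h).trans ?_
    have h1 : ν * η / q ≤ ν * cq := by
      rw [div_le_iff₀ hq, mul_assoc]
      exact mul_le_mul_of_nonneg_left hhq hν.le
    have e : 4 * MultiscaleRBF.constM d ^ 2 * ν ^ 2 * cq ^ 2 =
        4 * MultiscaleRBF.constM d ^ 2 * (ν * cq) ^ 2 := by ring
    rw [e]
    gcongr
  · refine (hΦ.cond₂_kernelMatrix_le_one hd hδ hsep (by linarith)).trans ?_
    have h1 : 1 ≤ 4 ^ d * (MultiscaleRBF.constC d * cΦ)⁻¹ := by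
      rw [← div_eq_mul_inv, one_le_div (by positivity)]
      exact hΦ.constC_mul_lower_le hd
    have h2 : 1 ≤ (1 + 4 * MultiscaleRBF.constM d ^ 2 * ν ^ 2 * cq ^ 2) ^ τ :=
      Real.one_le_rpow (le_add_of_nonneg_right (by positivity)) hτ.le
    exact one_le_mul_of_one_le_of_one_le h1 h2
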